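/- Let $A=\{1,2,3,5\}$, and let $T_n(x)=\frac{1}{x+n}$ on $[0,1]$ for $n\in A$. Let $$X_A=\Big\{\lim_{n\to\infty}T_{a_1}\circ T_{a_2}\circ\cdots\circ T_{a_n}(0)\;:\; a_k\in A\text{ for all }k\ge 1\Big\}$$ be the limit set of this iterated function scheme (equivalently, the set of numbers $[0;a_1,a_2,\dots]$ whose infinite continued fraction has all its digits in $A$). Then its Hausdorff dimension satisfies $$\dim_H(X_A)=0.7709149399375\pm 1.5\cdot 10^{-12},\qquad\text{i.e.}\qquad \bigl|\dim_H(X_A)-0.7709149399375\bigr|\le 1.5\cdot 10^{-12}.$$ In particular, $\dim_H(X_A)>3-\sqrt5$. -/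

import Mathlib

open Filter Topology

/-- The inverse branch `T_n(x) = 1 / (x + n)` of the Gauss map; for `n ≥ 1` it maps `[0,1]`
into `[0,1]`. -/
noncomputable def gaussBranch (n : ℕ) (x : ℝ) : ℝ := 1 / (x + n)

/-- The composition `T_{a 0} ∘ T_{a 1} ∘ ⋯ ∘ T_{a (n-1)}` of the maps of a family `T` along the
first `n` letters of the sequence `a` (the identity for `n = 0`). -/
def compAlong {ι : Type*} (T : ι → ℝ → ℝ) (a : ℕ → ι) : ℕ → ℝ → ℝ
  | 0 => id
  | n + 1 => compAlong T a n ∘ T (a n)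

/-- The limit set `X_A` of the iterated function scheme `T_n(x) = 1 / (x + n)`, `n ∈ A`, on `[0,1]`:
all limits `lim_{n → ∞} (T_{a 0} ∘ ⋯ ∘ T_{a (n-1)}) 0` over sequences `a` of letters from `A`. -/
def gaussLimitSet (A : Finset ℕ) : Set ℝ :=
  {x | ∃ a : ℕ → ℕ, (∀ k, a k ∈ A) ∧
    Tendsto (fun n => compAlong gaussBranch a n 0) atTop (𝓝 x)}

/-! Let `L f(x) = ∑ a ∈ A, (x + a) ^ (-2s) * f (1 / (x + a))` be the transfer operator. A positive
continuous `f` with `L f ≤ f` forces dimension at most `s`, and one with `f ≤ L f` forces dimension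
at least `s`. Indeed `L^n f (1)` is, up to constants, the sum of (diameter)^s over cylinders of
level `n`, because branch compositions are Möbius maps whose derivatives vary by a bounded factor.
In the first case these sums stay bounded and the Hausdorff measure is finite
(`dimH_gaussLimitSet_le`). In the second, every set of a cover is replaced by one comparable
cylinder (`exists_word_of_set`), compactness of `A^ℕ` leaves finitely many, and their total weight
is bounded below (`one_le_sum_wordScale`), so the measure is positive (`le_dimH_gaussLimitSet`).

It remains to exhibit `f` at the two ends of the claimed interval. Combinations of `(1 + β (x -
1/2)) ^ (-2s)` are convenient: composing with `1 / (x + n)` and multiplying by `(x + n) ^ (-2s)`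
gives again a power of an affine function. So `f - L f` is a finite combination of such powers. Its
binomial expansion at `x = 1/2` has a constant term that dominates all others
(`sum_rpow_nonneg_of_moments`), which is checked in rational arithmetic. -/

/-- The composition `T_{a₁} ∘ ⋯ ∘ T_{aₙ}` along the letters of a finite word. -/
noncomputable def wordMap : List ℕ → ℝ → ℝ
  | [] => id
  | a :: w => gaussBranch a ∘ wordMap w

/-- The square root of `|(wordMap w)'|`. -/
noncomputable def wordScale : List ℕ → ℝ → ℝ
  | [], _ => 1
  | a :: w, x => wordScale w x / (wordMap w x + a)

/-- The first `n` letters of a sequence. -/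
def seqPrefix (a : ℕ → ℕ) (n : ℕ) : List ℕ := (List.range n).map a

@[simp] lemma wordMap_nil (x : ℝ) : wordMap [] x = x := rfl

@[simp] lemma wordMap_cons (a : ℕ) (w : List ℕ) (x : ℝ) :
    wordMap (a :: w) x = 1 / (wordMap w x + a) := rfl

@[simp] lemma wordScale_nil (x : ℝ) : wordScale [] x = 1 := rfl

@[simp] lemma wordScale_cons (a : ℕ) (w : List ℕ) (x : ℝ) :
    wordScale (a :: w) x = wordScale w x / (wordMap w x + a) := rfl

@[simp] lemma length_seqPrefix (a : ℕ → ℕ) (n : ℕ) : (seqPrefix a n).length = n := by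
  simp [seqPrefix]

lemma mem_seqPrefix {A : Finset ℕ} {a : ℕ → ℕ} (ha : ∀ k, a k ∈ A) (n : ℕ) :
    ∀ b ∈ seqPrefix a n, b ∈ A := by
  intro b hb
  obtain ⟨k, -, rfl⟩ := List.mem_map.1 hb
  exact ha k

lemma seqPrefix_succ (a : ℕ → ℕ) (n : ℕ) : seqPrefix a (n + 1) = seqPrefix a n ++ [a n] := by
  simp [seqPrefix, List.range_succ]

lemma seqPrefix_eq_iff (a b : ℕ → ℕ) (n : ℕ) :
    seqPrefix a n = seqPrefix b n ↔ ∀ i < n, a i = b i := by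
  simp [seqPrefix]

lemma wordMap_append (w v : List ℕ) (x : ℝ) :
    wordMap (w ++ v) x = wordMap w (wordMap v x) := by
  induction w with
  | nil => rfl
  | cons a w ih => simp [ih]

lemma wordScale_append (w v : List ℕ) (x : ℝ) :
    wordScale (w ++ v) x = wordScale w (wordMap v x) * wordScale v x := by
  induction w with
  | nil => simp
  | cons a w ih => simp [ih, wordMap_append, div_mul_eq_mul_div]

lemma compAlong_eq_wordMap (a : ℕ → ℕ) (n : ℕ) (x : ℝ) :
    compAlong gaussBranch a n x = wordMap (seqPrefix a n) x := by
  induction n generalizing x with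
  | zero => rfl
  | succ n ih =>
    rw [seqPrefix_succ, wordMap_append, ← ih]
    rfl

lemma seqPrefix_add (a : ℕ → ℕ) (n m : ℕ) :
    seqPrefix a (n + m) = seqPrefix a n ++ seqPrefix (fun k => a (n + k)) m := by
  simp [seqPrefix, List.range_add, Function.comp_def]

/-! ### Möbius geometry and bounded distortion of the branches -/

section Geometry

variable {w : List ℕ} (hw : ∀ a ∈ w, 1 ≤ a)
include hw

lemma wordMap_mem_Icc {x : ℝ} (hx : x ∈ Set.Icc (0 : ℝ) 1) :
    wordMap w x ∈ Set.Icc (0 : ℝ) 1 := by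
  induction w with
  | nil => simpa using hx
  | cons a w ih =>
    have h := ih fun b hb => hw b (List.mem_cons_of_mem _ hb)
    have ha : (1 : ℝ) ≤ a := by exact_mod_cast hw a List.mem_cons_self
    have h1 : 1 ≤ wordMap w x + a := by linarith [h.1]
    rw [wordMap_cons]
    exact ⟨by positivity, by rw [div_le_one (by linarith)]; exact h1⟩

lemma wordScale_pos {x : ℝ} (hx : x ∈ Set.Icc (0 : ℝ) 1) : 0 < wordScale w x := by
  induction w with
  | nil => simp
  | cons a w ih =>
    have hw' : ∀ b ∈ w, 1 ≤ b := fun b hb => hw b (List.mem_cons_of_mem _ hb)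
    have ha : (1 : ℝ) ≤ a := by exact_mod_cast hw a List.mem_cons_self
    have h := (wordMap_mem_Icc hw' hx).1
    rw [wordScale_cons]
    exact div_pos (ih hw') (by linarith)

/-- The exact mean value formula for Möbius maps. -/
lemma abs_wordMap_sub {x y : ℝ} (hx : x ∈ Set.Icc (0 : ℝ) 1) (hy : y ∈ Set.Icc (0 : ℝ) 1) :
    |wordMap w x - wordMap w y| = |x - y| * (wordScale w x * wordScale w y) := by
  induction w with
  | nil => simp
  | cons a w ih =>
    have hw' : ∀ b ∈ w, 1 ≤ b := fun b hb => hw b (List.mem_cons_of_mem _ hb)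
    have ha : (1 : ℝ) ≤ a := by exact_mod_cast hw a List.mem_cons_self
    have h1 : 0 < wordMap w x + a := by linarith [(wordMap_mem_Icc hw' hx).1]
    have h2 : 0 < wordMap w y + a := by linarith [(wordMap_mem_Icc hw' hy).1]
    have h3 : wordMap (a :: w) x - wordMap (a :: w) y
        = -(wordMap w x - wordMap w y) / ((wordMap w x + a) * (wordMap w y + a)) := by
      rw [wordMap_cons, wordMap_cons]
      field_simp
      ring
    rw [h3, abs_div, abs_neg, abs_of_pos (mul_pos h1 h2), ih hw', wordScale_cons, wordScale_cons]
    field_simp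

/-- `q` and `q'` are continued fraction denominators. An inner letter `a` sends `(q, q')` to `(q a +
q', q)`, hence the induction from the right; letters at least 1 preserve `q' ≤ q`, which yields the
distortion constant 2. -/
lemma exists_wordScale_eq : ∃ q q' : ℝ, 0 < q ∧ 0 ≤ q' ∧ q' ≤ q ∧
    ∀ x ∈ Set.Icc (0 : ℝ) 1, wordScale w x = 1 / (q + q' * x) := by
  induction w using List.reverseRecOn with
  | nil => exact ⟨1, 0, by simp⟩
  | append_singleton w a ih =>
    obtain ⟨q, q', hq, hq', hle, h⟩ := ih fun b hb => hw b (by simp [hb])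
    have ha : (1 : ℝ) ≤ a := by exact_mod_cast hw a (by simp)
    refine ⟨q * a + q', q, by positivity, hq.le, by nlinarith, fun x hx => ?_⟩
    have hxa : 0 < x + a := by linarith [hx.1]
    have h1 : wordMap [a] x ∈ Set.Icc (0 : ℝ) 1 :=
      wordMap_mem_Icc (by simpa using hw a (by simp)) hx
    have h2 : 0 < q * a + q' + q * x := by nlinarith [hx.1]
    rw [wordScale_append, h _ h1]
    simp only [wordMap_cons, wordMap_nil, wordScale_cons, wordScale_nil]
    have h3 : q + q' * (1 / (x + a)) = (q * a + q' + q * x) / (x + a) := by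
      field_simp
      ring
    rw [h3]
    field_simp

lemma wordScale_le_two_mul {x y : ℝ} (hx : x ∈ Set.Icc (0 : ℝ) 1) (hy : y ∈ Set.Icc (0 : ℝ) 1) :
    wordScale w x ≤ 2 * wordScale w y := by
  obtain ⟨q, q', hq, hq', hle, h⟩ := exists_wordScale_eq hw
  have h1 := mul_nonneg hq' hx.1
  have h2 := mul_nonneg hq' hy.1
  have h3 := mul_le_mul_of_nonneg_left hy.2 hq'
  rw [h x hx, h y hy, mul_one_div, div_le_div_iff₀ (by linarith) (by linarith)]
  linarith

lemma inv_le_wordMap_one {M : ℕ} (hM : ∀ a ∈ w, a ≤ M) : 1 / ((M : ℝ) + 1) ≤ wordMap w 1 := by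
  cases w with
  | nil =>
    rw [wordMap_nil, div_le_one (by positivity)]
    linarith [(Nat.cast_nonneg M : (0 : ℝ) ≤ M)]
  | cons a w =>
    have hw' : ∀ b ∈ w, 1 ≤ b := fun b hb => hw b (List.mem_cons_of_mem _ hb)
    have ha : (a : ℝ) ≤ M := by exact_mod_cast hM a List.mem_cons_self
    have ha' : (1 : ℝ) ≤ a := by exact_mod_cast hw a List.mem_cons_self
    have h := wordMap_mem_Icc hw' (x := 1) (by simp)
    rw [wordMap_cons]
    exact one_div_le_one_div_of_le (by linarith [h.1]) (by linarith [h.2])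

/-- Evaluation at 1 rather than 0 keeps `wordMap w 1` above `1 / (M + 1)`, even for the empty word,
so every letter, including 1, contracts by a definite factor. -/
lemma wordScale_one_le {M : ℕ} (hM : ∀ a ∈ w, a ≤ M) :
    wordScale w 1 ≤ (((M : ℝ) + 1) / (M + 2)) ^ w.length := by
  induction w with
  | nil => simp
  | cons a w ih =>
    have hw' : ∀ b ∈ w, 1 ≤ b := fun b hb => hw b (List.mem_cons_of_mem _ hb)
    have hM' : ∀ b ∈ w, b ≤ M := fun b hb => hM b (List.mem_cons_of_mem _ hb)
    have ha : (1 : ℝ) ≤ a := by exact_mod_cast hw a List.mem_cons_self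
    have h := inv_le_wordMap_one hw' hM'
    have h1 : ((M : ℝ) + 2) / (M + 1) ≤ wordMap w 1 + a := by
      have : ((M : ℝ) + 2) / (M + 1) = 1 / (M + 1) + 1 := by field_simp; ring
      linarith
    rw [wordScale_cons, List.length_cons, pow_succ, div_eq_mul_inv]
    refine mul_le_mul (ih hw' hM') ?_ ?_ (by positivity)
    · rw [← inv_div]
      exact inv_anti₀ (by positivity) h1
    · exact inv_nonneg.2 (le_trans (by positivity) h1)

lemma continuousOn_wordMap : ContinuousOn (wordMap w) (Set.Icc 0 1) := by
  induction w with
  | nil => exact continuousOn_id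
  | cons a w ih =>
    have hw' : ∀ b ∈ w, 1 ≤ b := fun b hb => hw b (List.mem_cons_of_mem _ hb)
    have ha : (1 : ℝ) ≤ a := by exact_mod_cast hw a List.mem_cons_self
    have : wordMap (a :: w) = fun x => 1 / (wordMap w x + a) := rfl
    rw [this]
    refine continuousOn_const.div ((ih hw').add continuousOn_const) fun x hx => ?_
    linarith [(wordMap_mem_Icc hw' hx).1]

end Geometry

/-! ### Coding of limit points by sequences, and separation of cylinders -/

section Coding

variable {A : Finset ℕ} (hA : ∀ a ∈ A, 1 ≤ a)
include hA

lemma compAlong_mem_Icc {a : ℕ → ℕ} (ha : ∀ k, a k ∈ A) (n : ℕ) :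
    compAlong gaussBranch a n 0 ∈ Set.Icc (0 : ℝ) 1 := by
  rw [compAlong_eq_wordMap]
  exact wordMap_mem_Icc (fun b hb => hA b (mem_seqPrefix ha n b hb)) (by simp)

lemma exists_tendsto_compAlong {a : ℕ → ℕ} (ha : ∀ k, a k ∈ A) :
    ∃ x, Tendsto (fun n => compAlong gaussBranch a n 0) atTop (𝓝 x) := by
  set M := A.sup id
  have hM : ∀ b ∈ A, b ≤ M := fun b hb => Finset.le_sup (f := id) hb
  set ρ : ℝ := ((M : ℝ) + 1) / (M + 2)
  have hρ0 : 0 ≤ ρ := by positivity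
  have hρ : ρ < 1 := by rw [div_lt_one (by positivity)]; linarith
  have hρ2 : ρ ^ 2 < 1 := by nlinarith
  refine cauchySeq_tendsto_of_complete (cauchySeq_of_le_geometric (ρ ^ 2) 4 hρ2 fun n => ?_)
  have hw : ∀ b ∈ seqPrefix a n, 1 ≤ b := fun b hb => hA b (mem_seqPrefix ha n b hb)
  have hwM : ∀ b ∈ seqPrefix a n, b ≤ M := fun b hb => hM b (mem_seqPrefix ha n b hb)
  have h1 : wordMap [a n] 0 ∈ Set.Icc (0 : ℝ) 1 :=
    wordMap_mem_Icc (by simpa using hA _ (ha n)) (by simp)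
  have h0 : (0 : ℝ) ∈ Set.Icc (0 : ℝ) 1 := by simp
  have h1' : (1 : ℝ) ∈ Set.Icc (0 : ℝ) 1 := by simp
  rw [compAlong_eq_wordMap, compAlong_eq_wordMap, seqPrefix_succ, wordMap_append, Real.dist_eq,
    abs_wordMap_sub hw h0 h1]
  have hs := wordScale_one_le hw hwM
  rw [length_seqPrefix] at hs
  have hd : |0 - wordMap [a n] 0| ≤ 1 := by
    rw [zero_sub, abs_neg, abs_of_nonneg h1.1]
    exact h1.2
  have p0 := wordScale_pos hw h0
  have p1 := wordScale_pos hw h1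
  calc |0 - wordMap [a n] 0| * (wordScale (seqPrefix a n) 0 *
        wordScale (seqPrefix a n) (wordMap [a n] 0))
      ≤ 1 * ((2 * ρ ^ n) * (2 * ρ ^ n)) := by
        gcongr
        · exact (wordScale_le_two_mul hw h0 h1').trans (by linarith)
        · exact (wordScale_le_two_mul hw h1 h1').trans (by linarith)
    _ = 4 * (ρ ^ 2) ^ n := by ring_nf

lemma limit_mem_Icc {a : ℕ → ℕ} (ha : ∀ k, a k ∈ A) {x : ℝ}
    (hx : Tendsto (fun n => compAlong gaussBranch a n 0) atTop (𝓝 x)) :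
    x ∈ Set.Icc (0 : ℝ) 1 :=
  isClosed_Icc.mem_of_tendsto hx (Eventually.of_forall fun n => compAlong_mem_Icc hA ha n)

lemma exists_limit_shift {a : ℕ → ℕ} (ha : ∀ k, a k ∈ A) {x : ℝ}
    (hx : Tendsto (fun n => compAlong gaussBranch a n 0) atTop (𝓝 x)) (n : ℕ) :
    ∃ y ∈ Set.Icc (0 : ℝ) 1,
      Tendsto (fun m => compAlong gaussBranch (fun k => a (n + k)) m 0) atTop (𝓝 y) ∧
      x = wordMap (seqPrefix a n) y := by
  have ha' : ∀ k, a (n + k) ∈ A := fun k => ha _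
  obtain ⟨y, hy⟩ := exists_tendsto_compAlong hA ha'
  have hyI := limit_mem_Icc hA ha' hy
  refine ⟨y, hyI, hy, ?_⟩
  have hw : ∀ b ∈ seqPrefix a n, 1 ≤ b := fun b hb => hA b (mem_seqPrefix ha n b hb)
  have h1 : Tendsto (fun m => wordMap (seqPrefix a n)
      (compAlong gaussBranch (fun k => a (n + k)) m 0)) atTop (𝓝 (wordMap (seqPrefix a n) y)) :=
    (continuousOn_wordMap hw y hyI).tendsto.comp
      (tendsto_nhdsWithin_iff.2 ⟨hy, Eventually.of_forall fun m => compAlong_mem_Icc hA ha' m⟩)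
  refine tendsto_nhds_unique (hx.comp (tendsto_add_atTop_nat n)) (h1.congr fun m => ?_)
  simp only [Function.comp_apply, compAlong_eq_wordMap]
  rw [add_comm m n, seqPrefix_add, wordMap_append]

lemma limit_mem_Icc_of_le {M : ℕ} (hM : ∀ a ∈ A, a ≤ M) {a : ℕ → ℕ} (ha : ∀ k, a k ∈ A) {x : ℝ}
    (hx : Tendsto (fun n => compAlong gaussBranch a n 0) atTop (𝓝 x)) :
    x ∈ Set.Icc (1 / ((M : ℝ) + 1)) (((M : ℝ) + 1) / (M + 2)) := by
  -- Two letters are split off: the second keeps the inner point above `1 / (M + 1)`, and this keeps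
  -- the limit away from 1.
  obtain ⟨y, hy, -, rfl⟩ := exists_limit_shift hA ha hx 2
  have e : seqPrefix a 2 = [a 0, a 1] := rfl
  have h0 : (1 : ℝ) ≤ a 0 := by exact_mod_cast hA _ (ha 0)
  have h1 : (1 : ℝ) ≤ a 1 := by exact_mod_cast hA _ (ha 1)
  have h0' : (a 0 : ℝ) ≤ M := by exact_mod_cast hM _ (ha 0)
  have h1' : (a 1 : ℝ) ≤ M := by exact_mod_cast hM _ (ha 1)
  rw [e]
  simp only [wordMap_cons, wordMap_nil]
  have hz : 1 / ((M : ℝ) + 1) ≤ 1 / (y + a 1) :=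
    one_div_le_one_div_of_le (by linarith [hy.1]) (by linarith [hy.2])
  have hz' : 1 / (y + a 1) ≤ 1 := by
    rw [div_le_one (by linarith [hy.1])]
    linarith [hy.1]
  have hp : (0 : ℝ) < 1 / ((M : ℝ) + 1) := by positivity
  constructor
  · exact one_div_le_one_div_of_le (by linarith) (by linarith)
  · rw [div_le_div_iff₀ (by linarith) (by positivity)]
    have : ((M : ℝ) + 1) * (1 / ((M : ℝ) + 1)) = 1 := by field_simp
    nlinarith

/-- Limit points whose codes separate after `n` letters are at a distance comparable to the size
of their common cylinder. -/
lemma abs_limit_sub_ge {M : ℕ} (hM : ∀ a ∈ A, a ≤ M) {a b : ℕ → ℕ}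
    (ha : ∀ k, a k ∈ A) (hb : ∀ k, b k ∈ A) {x y : ℝ}
    (hx : Tendsto (fun n => compAlong gaussBranch a n 0) atTop (𝓝 x))
    (hy : Tendsto (fun n => compAlong gaussBranch b n 0) atTop (𝓝 y)) {n : ℕ}
    (hab : seqPrefix a n = seqPrefix b n) (hne : a n ≠ b n) :
    1 / (4 * ((M : ℝ) + 1) ^ 3) * wordScale (seqPrefix a n) 1 ^ 2 ≤ |x - y| := by
  obtain ⟨u, hu, hul, rfl⟩ := exists_limit_shift hA ha hx (n + 1)
  obtain ⟨v, hv, hvl, rfl⟩ := exists_limit_shift hA hb hy (n + 1)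
  have hu' := limit_mem_Icc_of_le hA hM (fun k => ha _) hul
  have hv' := limit_mem_Icc_of_le hA hM (fun k => hb _) hvl
  have hw : ∀ c ∈ seqPrefix a n, 1 ≤ c := fun c hc => hA c (mem_seqPrefix ha n c hc)
  have h1a : wordMap [a n] u ∈ Set.Icc (0 : ℝ) 1 :=
    wordMap_mem_Icc (by simpa using hA _ (ha n)) hu
  have h1b : wordMap [b n] v ∈ Set.Icc (0 : ℝ) 1 :=
    wordMap_mem_Icc (by simpa using hA _ (hb n)) hv
  have h1 : (1 : ℝ) ∈ Set.Icc (0 : ℝ) 1 := by simp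
  rw [seqPrefix_succ, seqPrefix_succ, ← hab, wordMap_append, wordMap_append,
    abs_wordMap_sub hw h1a h1b]
  have sa := wordScale_le_two_mul hw h1 h1a
  have sb := wordScale_le_two_mul hw h1 h1b
  have sp := wordScale_pos hw h1
  have qa : (1 : ℝ) ≤ a n := by exact_mod_cast hA _ (ha n)
  have qb : (1 : ℝ) ≤ b n := by exact_mod_cast hA _ (hb n)
  have qa' : (a n : ℝ) ≤ M := by exact_mod_cast hM _ (ha n)
  have qb' : (b n : ℝ) ≤ M := by exact_mod_cast hM _ (hb n)
  have hM0 : (0 : ℝ) ≤ M := Nat.cast_nonneg M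
  have hint : (1 : ℝ) ≤ |(b n : ℝ) - a n| := by
    have : (1 : ℤ) ≤ |(b n : ℤ) - a n| := Int.one_le_abs (by omega)
    exact_mod_cast this
  -- The tails differ by strictly less than 1 while the letters differ by at least 1; the slack `1 /
  -- (M + 1)` separates the two denominators.
  have hd : |v - u| ≤ 1 - 1 / ((M : ℝ) + 1) := by
    have e : ((M : ℝ) + 1) / (M + 2) ≤ 1 := by rw [div_le_one (by positivity)]; linarith
    rw [abs_le]
    constructor <;> linarith [hu'.1, hu'.2, hv'.1, hv'.2]
  have hnum : 1 / ((M : ℝ) + 1) ≤ |(v + b n) - (u + a n)| := by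
    have h2 : |(b n : ℝ) - a n| ≤ |(v + b n) - (u + a n)| + |v - u| := by
      have := abs_sub ((v + b n) - (u + a n)) (v - u)
      rwa [show (v + b n) - (u + a n) - (v - u) = (b n : ℝ) - a n by ring] at this
    linarith
  have hgap : 1 / ((M : ℝ) + 1) ^ 3 ≤ |wordMap [a n] u - wordMap [b n] v| := by
    have pa : 0 < u + a n := by linarith [hu.1]
    have pb : 0 < v + b n := by linarith [hv.1]
    simp only [wordMap_cons, wordMap_nil]
    rw [div_sub_div _ _ pa.ne' pb.ne', one_mul, mul_one, abs_div, abs_of_pos (mul_pos pa pb)]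
    calc 1 / ((M : ℝ) + 1) ^ 3 = 1 / (M + 1) / ((M + 1) * (M + 1)) := by field_simp
      _ ≤ _ := by
        refine div_le_div₀ (abs_nonneg _) hnum (mul_pos pa pb) (mul_le_mul ?_ ?_ pb.le (by positivity))
        · linarith [hu.2]
        · linarith [hv.2]
  -- The factor 1/4 is distortion, lost once for each of the two scales; the cube is the slack `1 /
  -- (M + 1)` over two denominators of size at most `M + 1`.
  calc 1 / (4 * ((M : ℝ) + 1) ^ 3) * wordScale (seqPrefix a n) 1 ^ 2
      = 1 / ((M : ℝ) + 1) ^ 3 *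
        ((wordScale (seqPrefix a n) 1 / 2) * (wordScale (seqPrefix a n) 1 / 2)) := by
        field_simp
        ring
    _ ≤ _ := by
      gcongr <;> linarith

end Coding

/-! ### Iterates of the transfer operator and the upper bound -/

/-- The words of length `n` in the alphabet `A`. -/
def words (A : Finset ℕ) : ℕ → Finset (List ℕ)
  | 0 => {[]}
  | n + 1 => (A ×ˢ words A n).image fun p => p.1 :: p.2

lemma mem_words {A : Finset ℕ} {n : ℕ} {w : List ℕ} :
    w ∈ words A n ↔ w.length = n ∧ ∀ a ∈ w, a ∈ A := by
  induction n generalizing w with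
  | zero =>
    simp only [words, Finset.mem_singleton, List.length_eq_zero_iff]
    constructor
    · rintro rfl
      simp
    · exact fun h => h.1
  | succ n ih =>
    simp only [words, Finset.mem_image, Finset.mem_product, Prod.exists]
    constructor
    · rintro ⟨a, v, ⟨ha, hv⟩, rfl⟩
      obtain ⟨h1, h2⟩ := ih.1 hv
      exact ⟨by simp [h1], by simpa [ha] using h2⟩
    · rintro ⟨h1, h2⟩
      cases w with
      | nil => simp at h1
      | cons a v =>
        exact ⟨a, v, ⟨h2 a (by simp), ih.2 ⟨by simpa using h1, fun b hb => h2 b (by simp [hb])⟩⟩, rfl⟩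

/-- The weight of a word in the iterates of the transfer operator applied to `f`, at the point
`1`. -/
noncomputable def wordWeight (e : ℝ) (f : ℝ → ℝ) (w : List ℕ) : ℝ :=
  wordScale w 1 ^ e * f (wordMap w 1)

/-- The value at `1` of the `n`-th iterate of the transfer operator applied to `f`. -/
noncomputable def wordSum (A : Finset ℕ) (e : ℝ) (f : ℝ → ℝ) (n : ℕ) : ℝ :=
  ∑ w ∈ words A n, wordWeight e f w

lemma ediam_wordMap_image_le {w : List ℕ} (hw : ∀ a ∈ w, 1 ≤ a) :
    Metric.ediam (wordMap w '' Set.Icc 0 1) ≤ ENNReal.ofReal (4 * wordScale w 1 ^ 2) := by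
  refine Metric.ediam_le ?_
  rintro _ ⟨x, hx, rfl⟩ _ ⟨y, hy, rfl⟩
  have h1 : (1 : ℝ) ∈ Set.Icc (0 : ℝ) 1 := by simp
  rw [edist_dist, Real.dist_eq, abs_wordMap_sub hw hx hy]
  refine ENNReal.ofReal_le_ofReal ?_
  have px := wordScale_pos hw hx
  have py := wordScale_pos hw hy
  have p1 := wordScale_pos hw h1
  have h2 : |x - y| ≤ 1 := abs_le.2 ⟨by linarith [hx.1, hy.2], by linarith [hx.2, hy.1]⟩
  calc |x - y| * (wordScale w x * wordScale w y)
      ≤ 1 * ((2 * wordScale w 1) * (2 * wordScale w 1)) := by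
        gcongr
        · exact wordScale_le_two_mul hw hx h1
        · exact wordScale_le_two_mul hw hy h1
    _ = 4 * wordScale w 1 ^ 2 := by ring

section

variable {A : Finset ℕ} (hA : ∀ a ∈ A, 1 ≤ a) {e : ℝ} {f : ℝ → ℝ}
include hA

lemma one_le_of_mem_words {n : ℕ} {w : List ℕ} (hw : w ∈ words A n) : ∀ a ∈ w, 1 ≤ a :=
  fun a ha => hA a ((mem_words.1 hw).2 a ha)

/-- The new letter is the outermost map, so for fixed `w` the sum over it is the transfer operator
at the point `wordMap w 1`. Pointwise inequalities between `f` and its image thus pass to all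
iterates. -/
lemma wordSum_succ (n : ℕ) : wordSum A e f (n + 1) = ∑ w ∈ words A n, wordScale w 1 ^ e *
    ∑ a ∈ A, (wordMap w 1 + a) ^ (-e) * f (1 / (wordMap w 1 + a)) := by
  have h1 : (1 : ℝ) ∈ Set.Icc (0 : ℝ) 1 := by simp
  rw [wordSum, words, Finset.sum_image (by
    rintro ⟨a, v⟩ - ⟨b, u⟩ - h
    simpa using h), Finset.sum_product_right]
  refine Finset.sum_congr rfl fun w hw => ?_
  have hw1 := one_le_of_mem_words hA hw
  rw [Finset.mul_sum]
  refine Finset.sum_congr rfl fun a ha => ?_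
  have h0 : 0 ≤ wordMap w 1 + a := add_nonneg (wordMap_mem_Icc hw1 h1).1 (Nat.cast_nonneg a)
  rw [wordWeight, wordScale_cons, wordMap_cons, Real.div_rpow (wordScale_pos hw1 h1).le h0,
    Real.rpow_neg h0]
  ring

lemma wordSum_anti (hL : ∀ x ∈ Set.Icc (0 : ℝ) 1,
    ∑ a ∈ A, (x + a) ^ (-e) * f (1 / (x + a)) ≤ f x) : Antitone (wordSum A e f) := by
  refine antitone_nat_of_succ_le fun n => ?_
  rw [wordSum_succ hA]
  refine Finset.sum_le_sum fun w hw => ?_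
  have h1 : (1 : ℝ) ∈ Set.Icc (0 : ℝ) 1 := by simp
  have hw1 := one_le_of_mem_words hA hw
  exact mul_le_mul_of_nonneg_left (hL _ (wordMap_mem_Icc hw1 h1))
    (Real.rpow_nonneg (wordScale_pos hw1 h1).le _)

lemma wordSum_mono (hL : ∀ x ∈ Set.Icc (0 : ℝ) 1,
    f x ≤ ∑ a ∈ A, (x + a) ^ (-e) * f (1 / (x + a))) : Monotone (wordSum A e f) := by
  refine monotone_nat_of_le_succ fun n => ?_
  rw [wordSum_succ hA]
  refine Finset.sum_le_sum fun w hw => ?_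
  have h1 : (1 : ℝ) ∈ Set.Icc (0 : ℝ) 1 := by simp
  have hw1 := one_le_of_mem_words hA hw
  exact mul_le_mul_of_nonneg_left (hL _ (wordMap_mem_Icc hw1 h1))
    (Real.rpow_nonneg (wordScale_pos hw1 h1).le _)

/-- **Upper bound for the dimension** from a positive subsolution of the transfer operator. -/
theorem dimH_gaussLimitSet_le {s : ℝ} (hs : 0 ≤ s) (hf : ContinuousOn f (Set.Icc 0 1))
    (hpos : ∀ x ∈ Set.Icc (0 : ℝ) 1, 0 < f x)
    (hL : ∀ x ∈ Set.Icc (0 : ℝ) 1, ∑ a ∈ A, (x + a) ^ (-(2 * s)) * f (1 / (x + a)) ≤ f x) :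
    dimH (gaussLimitSet A) ≤ ENNReal.ofReal s := by
  obtain ⟨x₀, hx₀, hmin⟩ := isCompact_Icc.exists_isMinOn (Set.nonempty_Icc.2 zero_le_one) hf
  have hm : 0 < f x₀ := hpos x₀ hx₀
  have h1 : (1 : ℝ) ∈ Set.Icc (0 : ℝ) 1 := by simp
  set M := A.sup id
  have hM : ∀ b ∈ A, b ≤ M := fun b hb => Finset.le_sup (f := id) hb
  set ρ : ℝ := ((M : ℝ) + 1) / (M + 2)
  have hρ0 : 0 ≤ ρ := by positivity
  have hρ : ρ < 1 := by rw [div_lt_one (by positivity)]; linarith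
  set C : ℝ := 4 ^ s * (f 1 / f x₀)
  -- Replacing `f` by its minimum in `wordSum` bounds the sum of the scales, since `wordSum` starts
  -- at `f 1` and decreases.
  have hbound : ∀ n, ∑ w : words A n, Metric.ediam (wordMap w '' Set.Icc 0 1) ^ s
      ≤ ENNReal.ofReal C := by
    intro n
    have hw1 := fun (w : words A n) => one_le_of_mem_words hA w.2
    have hp := fun (w : words A n) => wordScale_pos (hw1 w) h1
    calc ∑ w : words A n, Metric.ediam (wordMap w '' Set.Icc 0 1) ^ s
        ≤ ∑ w : words A n, ENNReal.ofReal (4 ^ s * wordScale w 1 ^ (2 * s)) := by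
          refine Finset.sum_le_sum fun w _ => ?_
          refine (ENNReal.rpow_le_rpow (ediam_wordMap_image_le (hw1 w)) hs).trans_eq ?_
          rw [ENNReal.ofReal_rpow_of_nonneg (by positivity) hs,
            Real.mul_rpow (by norm_num) (by positivity), Real.rpow_mul (hp w).le, Real.rpow_two]
      _ = ENNReal.ofReal (∑ w : words A n, 4 ^ s * wordScale w 1 ^ (2 * s)) := by
          rw [ENNReal.ofReal_sum_of_nonneg]
          exact fun w _ => mul_nonneg (by positivity) (Real.rpow_nonneg (hp w).le _)
      _ ≤ ENNReal.ofReal C := by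
          refine ENNReal.ofReal_le_ofReal ?_
          have h2 : wordSum A (2 * s) f n ≤ f 1 := by
            have := wordSum_anti hA hL (Nat.zero_le n)
            simpa [wordSum, words, wordWeight] using this
          rw [← Finset.mul_sum, Finset.sum_coe_sort (words A n) fun w => wordScale w 1 ^ (2 * s)]
          refine mul_le_mul_of_nonneg_left ?_ (by positivity)
          rw [le_div_iff₀ hm, Finset.sum_mul]
          refine le_trans (Finset.sum_le_sum fun w hw => ?_) h2
          have hw1 := one_le_of_mem_words hA hw
          exact mul_le_mul_of_nonneg_left (hmin (wordMap_mem_Icc hw1 h1))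
            (Real.rpow_nonneg (wordScale_pos hw1 h1).le _)
  have hle := MeasureTheory.Measure.hausdorffMeasure_le_liminf_sum s (gaussLimitSet A)
    (l := atTop) (fun n => ENNReal.ofReal (4 * (ρ ^ n) ^ 2)) (by
      have h2 : Tendsto (fun n : ℕ => 4 * (ρ ^ n) ^ 2) atTop (𝓝 (4 * 0 ^ 2)) :=
        ((tendsto_pow_atTop_nhds_zero_of_lt_one hρ0 hρ).pow 2).const_mul 4
      simpa using ENNReal.tendsto_ofReal h2)
    (fun n (w : words A n) => wordMap w '' Set.Icc 0 1)
    (Eventually.of_forall fun n w => by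
      have hw1 := one_le_of_mem_words hA w.2
      obtain ⟨hl, hm⟩ := mem_words.1 w.2
      refine (ediam_wordMap_image_le hw1).trans (ENNReal.ofReal_le_ofReal ?_)
      have := wordScale_one_le hw1 fun a ha => hM a (hm a ha)
      rw [hl] at this
      have := (wordScale_pos hw1 h1).le
      gcongr)
    (Eventually.of_forall fun n => by
      rintro x ⟨a, ha, hx⟩
      obtain ⟨y, hy, -, rfl⟩ := exists_limit_shift hA ha hx n
      exact Set.mem_iUnion.2 ⟨⟨seqPrefix a n, mem_words.2 ⟨by simp, mem_seqPrefix ha n⟩⟩,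
        y, hy, rfl⟩)
  have hfin : MeasureTheory.Measure.hausdorffMeasure s (gaussLimitSet A) ≠ ⊤ := by
    refine (hle.trans ?_).trans_lt (ENNReal.ofReal_lt_top (r := C)) |>.ne
    exact (liminf_le_liminf (Eventually.of_forall hbound)).trans_eq (by simp)
  have := dimH_le_of_hausdorffMeasure_ne_top (d := ⟨s, hs⟩) hfin
  rwa [ENNReal.ofReal, Real.toNNReal_of_nonneg hs]

end

/-! ### Mass distribution over cylinders and the lower bound -/

lemma isOpen_setOf_seqPrefix_eq (w : List ℕ) :
    IsOpen {a : ℕ → ℕ | seqPrefix a w.length = w} := by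
  refine isOpen_iff_mem_nhds.2 fun a ha => ?_
  have h : (⋂ i ∈ Finset.range w.length, {b : ℕ → ℕ | b i = a i}) ∈ 𝓝 a :=
    (Finset.iInter_mem_sets _).2 fun i _ =>
      ((isOpen_discrete ({a i} : Set ℕ)).preimage (continuous_apply i)).mem_nhds
        (Set.mem_singleton _)
  refine mem_of_superset h fun b hb => ?_
  simp only [Set.mem_iInter, Finset.mem_range, Set.mem_ofPred_eq] at hb ha ⊢
  rw [← ha, length_seqPrefix]
  exact (seqPrefix_eq_iff _ _ _).2 hb

section

variable {A : Finset ℕ} (hA : ∀ a ∈ A, 1 ≤ a)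
include hA

/-- The part of the limit set in a set `t` lies in a cylinder that is comparable to `t`. -/
lemma exists_word_of_set (hne : A.Nonempty) {M : ℕ} (hM : ∀ a ∈ A, a ≤ M) (t : Set ℝ) {η : ℝ}
    (hη : 0 < η) : ∃ w : List ℕ, (∀ a ∈ w, a ∈ A) ∧
      (∀ a : ℕ → ℕ, (∀ k, a k ∈ A) → ∀ x ∈ t,
        Tendsto (fun n => compAlong gaussBranch a n 0) atTop (𝓝 x) →
        seqPrefix a w.length = w) ∧
      ((t.Nonempty ∧ ENNReal.ofReal (1 / (4 * ((M : ℝ) + 1) ^ 3) * wordScale w 1 ^ 2)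
          ≤ Metric.ediam t) ∨
        1 / (4 * ((M : ℝ) + 1) ^ 3) * wordScale w 1 ^ 2 ≤ η) := by
  classical
  let Code : (ℕ → ℕ) → Prop := fun a => (∀ k, a k ∈ A) ∧
    ∃ x ∈ t, Tendsto (fun n => compAlong gaussBranch a n 0) atTop (𝓝 x)
  obtain ⟨a₀, ha₀⟩ := hne
  -- The first disagreement between codes of points of `t` ends their longest common prefix, and two
  -- disagreeing points make `t` at least as large as a fixed multiple of that cylinder.
  by_cases h : ∃ n, ∃ a b, Code a ∧ Code b ∧ seqPrefix a n ≠ seqPrefix b n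
  · obtain ⟨a, b, ⟨ha, x, hxt, hx⟩, ⟨hb, y, hyt, hy⟩, hab⟩ := Nat.find_spec h
    have hmin := fun m (hm : m < Nat.find h) => Nat.find_min h hm
    obtain ⟨m, hm⟩ : ∃ m, Nat.find h = m + 1 := by
      refine Nat.exists_eq_succ_of_ne_zero fun h0 => hab ?_
      rw [h0]
      rfl
    rw [hm] at hab hmin
    have key : ∀ b', Code b' → seqPrefix b' m = seqPrefix a m := fun b' hb' => by
      by_contra hcon
      exact hmin m (Nat.lt_succ_self m) ⟨b', a, hb', ⟨ha, x, hxt, hx⟩, hcon⟩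
    have hpre : seqPrefix a m = seqPrefix b m := (key b ⟨hb, y, hyt, hy⟩).symm
    have hneq : a m ≠ b m := fun h' => hab (by rw [seqPrefix_succ, seqPrefix_succ, hpre, h'])
    refine ⟨seqPrefix a m, mem_seqPrefix ha m, fun b' hb' z hz hbz => ?_, Or.inl ⟨⟨x, hxt⟩, ?_⟩⟩
    · rw [length_seqPrefix]
      exact key b' ⟨hb', z, hz, hbz⟩
    · refine le_trans ?_ (Metric.edist_le_ediam_of_mem hxt hyt)
      rw [edist_dist, Real.dist_eq]
      exact ENNReal.ofReal_le_ofReal (abs_limit_sub_ge hA hM ha hb hx hy hpre hneq)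
  -- All codes of points of `t` agree, so `t` may have diameter zero; a long prefix then has size
  -- below `η`. If there is no code at all, any long word serves.
  · push Not at h
    set ρ : ℝ := ((M : ℝ) + 1) / (M + 2)
    have hρ0 : 0 ≤ ρ := by positivity
    have hρ : ρ < 1 := by rw [div_lt_one (by positivity)]; linarith
    obtain ⟨n, hn⟩ := exists_pow_lt_of_lt_one hη hρ
    have hsmall : ∀ a : ℕ → ℕ, (∀ k, a k ∈ A) →
        1 / (4 * ((M : ℝ) + 1) ^ 3) * wordScale (seqPrefix a n) 1 ^ 2 ≤ η := fun a ha => by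
      have hw : ∀ b ∈ seqPrefix a n, b ∈ A := mem_seqPrefix ha n
      have h1 := wordScale_one_le (fun b hb => hA b (hw b hb)) fun b hb => hM b (hw b hb)
      have h0 := wordScale_pos (fun b hb => hA b (hw b hb)) (x := 1) (by simp)
      rw [length_seqPrefix] at h1
      have h2 : ρ ^ n ≤ 1 := pow_le_one₀ hρ0 hρ.le
      have h3 : 1 / (4 * ((M : ℝ) + 1) ^ 3) ≤ 1 := by
        rw [div_le_one (by positivity)]
        have : (1 : ℝ) ≤ ((M : ℝ) + 1) ^ 3 :=
          one_le_pow₀ (by linarith [(Nat.cast_nonneg M : (0 : ℝ) ≤ M)])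
        linarith
      calc 1 / (4 * ((M : ℝ) + 1) ^ 3) * wordScale (seqPrefix a n) 1 ^ 2 ≤ 1 * ρ ^ n := by
            refine mul_le_mul h3 ?_ (by positivity) zero_le_one
            nlinarith
        _ ≤ η := by linarith
    by_cases hc : ∃ a, Code a
    · obtain ⟨a, ha⟩ := hc
      refine ⟨seqPrefix a n, mem_seqPrefix ha.1 n, fun b hb z hz hbz => ?_,
        Or.inr (hsmall a ha.1)⟩
      rw [length_seqPrefix]
      exact h n b a ⟨hb, z, hz, hbz⟩ ha
    · push Not at hc
      exact ⟨seqPrefix (fun _ => a₀) n, mem_seqPrefix (fun _ => ha₀) n,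
        fun b hb z hz hbz => absurd ⟨hb, z, hz, hbz⟩ (hc b), Or.inr (hsmall _ fun _ => ha₀)⟩

variable {e : ℝ} {f : ℝ → ℝ}

/-- Weights are submultiplicative up to a constant: `2 ^ e` comes from distortion, `K / m` from the
variation of `f`. -/
lemma wordWeight_append_le (he : 0 ≤ e) {m K : ℝ} (hm : 0 < m)
    (hmf : ∀ x ∈ Set.Icc (0 : ℝ) 1, m ≤ f x) (hKf : ∀ x ∈ Set.Icc (0 : ℝ) 1, f x ≤ K)
    {w v : List ℕ} (hw : ∀ a ∈ w, a ∈ A) (hv : ∀ a ∈ v, a ∈ A) :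
    wordWeight e f (w ++ v) ≤ 2 ^ e * (K / m) * wordScale w 1 ^ e * wordWeight e f v := by
  have h1 : (1 : ℝ) ∈ Set.Icc (0 : ℝ) 1 := by simp
  have hw1 : ∀ a ∈ w, 1 ≤ a := fun a ha => hA a (hw a ha)
  have hv1 : ∀ a ∈ v, 1 ≤ a := fun a ha => hA a (hv a ha)
  have hv2 := wordMap_mem_Icc hv1 h1
  have hwv := wordMap_mem_Icc hw1 hv2
  have pw := wordScale_pos hw1 h1
  have pw' := wordScale_pos hw1 hv2
  have pv := wordScale_pos hv1 h1
  have hf1 := hmf _ hv2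
  have hK : 0 ≤ K := (hm.le.trans (hmf 1 h1)).trans (hKf 1 h1)
  rw [wordWeight, wordWeight, wordScale_append, wordMap_append, Real.mul_rpow pw'.le pv.le]
  have a1 : wordScale w (wordMap v 1) ^ e ≤ 2 ^ e * wordScale w 1 ^ e := by
    rw [← Real.mul_rpow (by norm_num) pw.le]
    exact Real.rpow_le_rpow pw'.le (wordScale_le_two_mul hw1 hv2 h1) he
  have a2 : f (wordMap w (wordMap v 1)) ≤ K / m * f (wordMap v 1) := by
    rw [div_mul_eq_mul_div, le_div_iff₀ hm]
    exact mul_le_mul (hKf _ hwv) hf1 hm.le hK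
  have p1 := Real.rpow_nonneg pv.le e
  have p2 := Real.rpow_nonneg pw.le e
  have p3 : 0 ≤ f (wordMap w (wordMap v 1)) := hm.le.trans (hmf _ hwv)
  calc wordScale w (wordMap v 1) ^ e * wordScale v 1 ^ e * f (wordMap w (wordMap v 1))
      ≤ (2 ^ e * wordScale w 1 ^ e) * wordScale v 1 ^ e * (K / m * f (wordMap v 1)) := by
        gcongr
    _ = _ := by ring

/-- A finite family of cylinders that covers the whole sequence space has weight bounded below. -/
lemma one_le_sum_wordScale (hne : A.Nonempty) (he : 0 ≤ e) {m K : ℝ} (hm : 0 < m)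
    (hmf : ∀ x ∈ Set.Icc (0 : ℝ) 1, m ≤ f x) (hKf : ∀ x ∈ Set.Icc (0 : ℝ) 1, f x ≤ K)
    (hL : ∀ x ∈ Set.Icc (0 : ℝ) 1, f x ≤ ∑ a ∈ A, (x + a) ^ (-e) * f (1 / (x + a)))
    {ι : Type*} (I : Finset ι) (w : ι → List ℕ) (hw : ∀ i, ∀ a ∈ w i, a ∈ A)
    (hcov : ∀ a : ℕ → ℕ, (∀ k, a k ∈ A) → ∃ i ∈ I, seqPrefix a (w i).length = w i) :
    1 ≤ 2 ^ e * (K / m) * ∑ i ∈ I, wordScale (w i) 1 ^ e := by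
  classical
  obtain ⟨a₀, ha₀⟩ := hne
  have h1 : (1 : ℝ) ∈ Set.Icc (0 : ℝ) 1 := by simp
  have hK : 0 ≤ K := (hm.le.trans (hmf 1 h1)).trans (hKf 1 h1)
  have hnn : ∀ v : List ℕ, (∀ a ∈ v, a ∈ A) → 0 ≤ wordWeight e f v := fun v hv => by
    have hv1 : ∀ a ∈ v, 1 ≤ a := fun a ha => hA a (hv a ha)
    exact mul_nonneg (Real.rpow_nonneg (wordScale_pos hv1 h1).le _)
      (hm.le.trans (hmf _ (wordMap_mem_Icc hv1 h1)))
  have hmono := wordSum_mono hA hL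
  set n := I.sup fun i => (w i).length
  have hn : ∀ i ∈ I, (w i).length ≤ n := fun i hi => Finset.le_sup (f := fun i => (w i).length) hi
  have hpos : 0 < wordSum A e f n := by
    refine lt_of_lt_of_le ?_ (hmono (Nat.zero_le n))
    simpa [wordSum, words, wordWeight] using hm.trans_le (hmf 1 h1)
  have hdec : ∀ u ∈ words A n, ∃ i ∈ I, ∃ v ∈ words A (n - (w i).length), u = w i ++ v := by
    intro u hu
    obtain ⟨hul, huA⟩ := mem_words.1 hu
    -- The default letter `a₀` only turns `u` into an infinite sequence; prefixes of length at most
    -- `n` do not see it.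
    have haA : ∀ k, u.getD k a₀ ∈ A := fun k => by
      by_cases hk : k < u.length
      · rw [List.getD_eq_getElem _ _ hk]
        exact huA _ (List.getElem_mem hk)
      · rw [List.getD_eq_default _ _ (not_lt.1 hk)]
        exact ha₀
    obtain ⟨i, hi, hpre⟩ := hcov (fun k => u.getD k a₀) haA
    have htake : u.take (w i).length = w i := by
      refine Eq.trans ?_ hpre
      refine List.ext_getElem (by simp [hul, hn i hi]) fun k hk _ => ?_
      have hk' : k < u.length := by
        rw [List.length_take] at hk
        omega
      simp [seqPrefix, hk']
    refine ⟨i, hi, u.drop (w i).length, mem_words.2 ⟨by simp [hul], fun a ha =>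
      huA a (List.mem_of_mem_drop ha)⟩, ?_⟩
    conv_lhs => rw [← List.take_append_drop (w i).length u, htake]
  -- Words of length `n` are grouped by the covering prefix. The remaining letters contribute a
  -- shorter `wordSum`, at most the full one by monotonicity, which then cancels.
  have hle : wordSum A e f n
      ≤ (2 ^ e * (K / m) * ∑ i ∈ I, wordScale (w i) 1 ^ e) * wordSum A e f n := by
    calc wordSum A e f n
        ≤ ∑ u ∈ words A n, ∑ i ∈ I, if (∃ v ∈ words A (n - (w i).length), u = w i ++ v)
            then wordWeight e f u else 0 := by
          refine Finset.sum_le_sum fun u hu => ?_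
          obtain ⟨i, hi, hv⟩ := hdec u hu
          have := Finset.single_le_sum (f := fun i =>
            if (∃ v ∈ words A (n - (w i).length), u = w i ++ v) then wordWeight e f u else 0)
            (fun j _ => by
              split_ifs
              exacts [hnn u (mem_words.1 hu).2, le_rfl]) hi
          simpa only [if_pos hv] using this
      _ = ∑ i ∈ I, ∑ u ∈ words A n with ∃ v ∈ words A (n - (w i).length), u = w i ++ v,
            wordWeight e f u := by
          rw [Finset.sum_comm]
          simp only [Finset.sum_filter]
      _ ≤ ∑ i ∈ I, ∑ u ∈ (words A (n - (w i).length)).image (w i ++ ·), wordWeight e f u := by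
          refine Finset.sum_le_sum fun i _ => Finset.sum_le_sum_of_subset_of_nonneg ?_ ?_
          · intro u hu
            obtain ⟨v, hv, rfl⟩ := (Finset.mem_filter.1 hu).2
            exact Finset.mem_image_of_mem _ hv
          · intro u hu _
            obtain ⟨v, hv, rfl⟩ := Finset.mem_image.1 hu
            refine hnn _ fun a ha => ?_
            rcases List.mem_append.1 ha with ha | ha
            exacts [hw i a ha, (mem_words.1 hv).2 a ha]
      _ ≤ ∑ i ∈ I, 2 ^ e * (K / m) * wordScale (w i) 1 ^ e * wordSum A e f n := by
          refine Finset.sum_le_sum fun i _ => ?_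
          rw [Finset.sum_image fun _ _ _ _ h => List.append_cancel_left h]
          have hC : 0 ≤ 2 ^ e * (K / m) * wordScale (w i) 1 ^ e := by
            have := Real.rpow_nonneg
              (wordScale_pos (fun a ha => hA a (hw i a ha)) h1).le e
            positivity
          refine le_trans (Finset.sum_le_sum fun v hv =>
            wordWeight_append_le hA he hm hmf hKf (hw i) (mem_words.1 hv).2) ?_
          rw [← Finset.mul_sum]
          exact mul_le_mul_of_nonneg_left (hmono (Nat.sub_le _ _)) hC
      _ = _ := by rw [Finset.mul_sum, Finset.sum_mul]
  exact le_of_mul_le_mul_right (by linarith) hpos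

/-- **Lower bound for the dimension** from a positive supersolution of the transfer operator. -/
theorem le_dimH_gaussLimitSet (hne : A.Nonempty) {s : ℝ} (hs : 0 < s)
    (hf : ContinuousOn f (Set.Icc 0 1)) (hpos : ∀ x ∈ Set.Icc (0 : ℝ) 1, 0 < f x)
    (hL : ∀ x ∈ Set.Icc (0 : ℝ) 1,
      f x ≤ ∑ a ∈ A, (x + a) ^ (-(2 * s)) * f (1 / (x + a))) :
    ENNReal.ofReal s ≤ dimH (gaussLimitSet A) := by
  have hI : (Set.Icc (0 : ℝ) 1).Nonempty := Set.nonempty_Icc.2 zero_le_one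
  obtain ⟨x₀, hx₀, hmin⟩ := isCompact_Icc.exists_isMinOn hI hf
  obtain ⟨x₁, hx₁, hmax⟩ := isCompact_Icc.exists_isMaxOn hI hf
  have hm : 0 < f x₀ := hpos x₀ hx₀
  have hK : 0 < f x₁ := hpos x₁ hx₁
  have h1 : (1 : ℝ) ∈ Set.Icc (0 : ℝ) 1 := by simp
  set M := A.sup id
  have hM : ∀ b ∈ A, b ≤ M := fun b hb => Finset.le_sup (f := id) hb
  set κ : ℝ := 1 / (4 * ((M : ℝ) + 1) ^ 3)
  have hκ : 0 < κ := by positivity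
  set C : ℝ := 2 ^ (2 * s) * (f x₁ / f x₀)
  have hC : 0 < C := by positivity
  -- Half of `κ ^ s / C` is allotted to the cover and half to the errors `ε i`.
  set δ : ENNReal := ENNReal.ofReal (κ ^ s / C / 2)
  have hδ : 0 < δ := ENNReal.ofReal_pos.2 (by positivity)
  have hzero : MeasureTheory.Measure.hausdorffMeasure s (gaussLimitSet A) ≠ 0 := by
    intro h0
    rw [MeasureTheory.Measure.hausdorffMeasure_apply] at h0
    -- Mesh bound `⊤` suffices: even covers by large sets cannot have a small sum.
    have h0' := le_antisymm ((le_iSup₂ (f := fun (r : ENNReal) (_ : 0 < r) =>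
      ⨅ (t : ℕ → Set ℝ) (_ : gaussLimitSet A ⊆ ⋃ n, t n) (_ : ∀ n, Metric.ediam (t n) ≤ r),
        ∑' n, ⨆ _ : (t n).Nonempty, Metric.ediam (t n) ^ s) ⊤ (by simp)).trans h0.le) zero_le
    rw [← h0'] at hδ
    simp only [iInf_lt_iff] at hδ
    obtain ⟨t, ht, -, hsum⟩ := hδ
    obtain ⟨ε, hε, hεsum⟩ := ENNReal.exists_pos_sum_of_countable
      (ENNReal.ofReal_pos.2 (by positivity : 0 < κ ^ s / C / 2)).ne' ℕ
    -- The choice `η = ε i ^ (1 / s)` makes the error after raising to the power `s` equal to `ε i`.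
    choose w hwA hwt hwd using fun i => exists_word_of_set hA hne hM (t i)
      (Real.rpow_pos_of_pos (NNReal.coe_pos.2 (hε i)) (1 / s))
    have hp : ∀ i, 0 < wordScale (w i) 1 := fun i =>
      wordScale_pos (fun a ha => hA a (hwA i a ha)) h1
    have hterm : ∀ i, ENNReal.ofReal ((κ * wordScale (w i) 1 ^ 2) ^ s) ≤
        (⨆ _ : (t i).Nonempty, Metric.ediam (t i) ^ s) + ε i := by
      intro i
      have hp2 : 0 ≤ κ * wordScale (w i) 1 ^ 2 := by positivity
      rcases hwd i with ⟨hti, hd⟩ | hd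
      · refine le_add_right ?_
        rw [iSup_pos hti, ← ENNReal.ofReal_rpow_of_nonneg hp2 hs.le]
        exact ENNReal.rpow_le_rpow hd hs.le
      · refine le_add_left ?_
        rw [← ENNReal.ofReal_coe_nnreal]
        refine ENNReal.ofReal_le_ofReal ((Real.rpow_le_rpow hp2 hd hs.le).trans_eq ?_)
        rw [← Real.rpow_mul (NNReal.coe_nonneg _), one_div_mul_cancel hs.ne', Real.rpow_one]
    -- Compactness is used in sequence space, where cylinders are open; the sets `t i` need not be.
    have hcompact : IsCompact (Set.univ.pi fun _ : ℕ => (A : Set ℕ)) :=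
      isCompact_univ_pi fun _ => A.finite_toSet.isCompact
    obtain ⟨I, hIcov⟩ := hcompact.elim_finite_subcover
      (fun i => {a : ℕ → ℕ | seqPrefix a (w i).length = w i})
      (fun i => isOpen_setOf_seqPrefix_eq (w i)) (by
        intro a ha
        have ha' : ∀ k, a k ∈ A := fun k => ha k trivial
        obtain ⟨x, hx⟩ := exists_tendsto_compAlong hA ha'
        obtain ⟨i, hi⟩ := Set.mem_iUnion.1 (ht ⟨a, ha', hx⟩)
        exact Set.mem_iUnion.2 ⟨i, hwt i a ha' x hi hx⟩)
    have hone := one_le_sum_wordScale hA hne (by positivity : 0 ≤ 2 * s) hm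
      (fun x hx => hmin hx) (fun x hx => hmax hx) hL I w hwA fun a ha => by
        obtain ⟨i, hi, h⟩ := Set.mem_iUnion₂.1 (hIcov fun k _ => ha k)
        exact ⟨i, hi, h⟩
    have hreal : κ ^ s / C ≤ ∑ i ∈ I, (κ * wordScale (w i) 1 ^ 2) ^ s := by
      have : ∀ i ∈ I, (κ * wordScale (w i) 1 ^ 2) ^ s = κ ^ s * wordScale (w i) 1 ^ (2 * s) := by
        intro i _
        rw [Real.mul_rpow hκ.le (by positivity), Real.rpow_mul (hp i).le, Real.rpow_two]
      rw [Finset.sum_congr rfl this, ← Finset.mul_sum, div_le_iff₀ hC]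
      have := mul_le_mul_of_nonneg_left hone (Real.rpow_nonneg hκ.le s)
      linarith
    have hbad : ENNReal.ofReal (κ ^ s / C) < ENNReal.ofReal (κ ^ s / C) :=
      calc ENNReal.ofReal (κ ^ s / C)
          ≤ ENNReal.ofReal (∑ i ∈ I, (κ * wordScale (w i) 1 ^ 2) ^ s) :=
            ENNReal.ofReal_le_ofReal hreal
        _ = ∑ i ∈ I, ENNReal.ofReal ((κ * wordScale (w i) 1 ^ 2) ^ s) :=
            ENNReal.ofReal_sum_of_nonneg fun i _ => by positivity
        _ ≤ ∑ i ∈ I, ((⨆ _ : (t i).Nonempty, Metric.ediam (t i) ^ s) + ε i) :=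
            Finset.sum_le_sum fun i _ => hterm i
        _ ≤ ∑' i, ((⨆ _ : (t i).Nonempty, Metric.ediam (t i) ^ s) + ε i) :=
            ENNReal.sum_le_tsum I
        _ = (∑' i, ⨆ _ : (t i).Nonempty, Metric.ediam (t i) ^ s) + ∑' i, (ε i : ENNReal) :=
            ENNReal.tsum_add
        _ < δ + δ := ENNReal.add_lt_add hsum hεsum
        _ = ENNReal.ofReal (κ ^ s / C) := by
            rw [← ENNReal.ofReal_add (by positivity) (by positivity), add_halves]
    exact lt_irrefl _ hbad
  have := le_dimH_of_hausdorffMeasure_ne_zero (d := ⟨s, hs.le⟩) hzero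
  rwa [ENNReal.ofReal, Real.toNNReal_of_nonneg hs.le]

end

/-! ### Binomial expansion and the moment criterion -/

/-- Consecutive coefficients have ratio at most `(k + 2) / (k + 1)` in absolute value when `e ≤ 2`;
equality at `e = 2` gives `k + 1`. -/
lemma abs_choose_neg_le {e : ℝ} (he : 0 ≤ e) (he2 : e ≤ 2) (k : ℕ) :
    |Ring.choose (-e) k| ≤ k + 1 := by
  induction k with
  | zero => simp
  | succ k ih =>
    have h : Ring.choose (-e) (k + 1) * (k + 1) = Ring.choose (-e) k * (-e - k) := by
      have hk : ((k.factorial : ℕ) : ℝ) ≠ 0 := by exact_mod_cast k.factorial_ne_zero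
      rw [Ring.choose_eq_smul, Ring.choose_eq_smul, descPochhammer_succ_right,
        Polynomial.smeval_mul, Polynomial.smeval_sub, Polynomial.smeval_X,
        Polynomial.smeval_natCast, Nat.factorial_succ]
      push_cast
      simp only [smul_eq_mul, pow_one, pow_zero, nsmul_eq_mul, mul_one]
      field_simp
    have hk : (0 : ℝ) < k + 1 := by positivity
    have h2 : |Ring.choose (-e) (k + 1)| * (k + 1) ≤ (k + 1) * (k + 2) := by
      rw [← abs_of_pos hk, ← abs_mul, h, abs_mul, abs_of_pos hk]
      refine mul_le_mul ih ?_ (abs_nonneg _) hk.le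
      rw [abs_le]
      constructor <;> linarith
    push_cast
    nlinarith

lemma hasSum_one_add_rpow (a : ℝ) {z : ℝ} (hz : |z| < 1) :
    HasSum (fun k => Ring.choose a k * z ^ k) ((1 + z) ^ a) := by
  have h := (Real.one_add_rpow_hasFPowerSeriesOnBall_zero (a := a)).hasSum (y := z) (by
    simpa [Metric.mem_eball, edist_dist, Real.dist_eq] using hz)
  simpa only [binomialSeries_apply, List.ofFn_const, List.prod_replicate, smul_eq_mul,
    zero_add] using h

/-- The base 4/3 is such that `4/3 * 1/2 * 3/5 = 2/5`, the ratio of the geometric tail in the moment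
criterion. -/
lemma natCast_add_one_le (k : ℕ) : (k : ℝ) + 1 ≤ 3 * (4 / 3) ^ k := by
  have := one_add_mul_le_pow (a := (1 / 3 : ℝ)) (by norm_num) k
  norm_num at this
  linarith

/-- A criterion for the nonnegativity of a combination of negative powers of affine functions on
`[-1/2, 1/2]` in terms of its moments. -/
lemma sum_rpow_nonneg_of_moments {ι : Type*} [Fintype ι] {e : ℝ} (he : 0 ≤ e) (he2 : e ≤ 2)
    (d g : ι → ℝ) (hg : ∀ i, |g i| ≤ 3 / 5) {t : ℝ} (ht : |t| ≤ 1 / 2) (N : ℕ) {S : ℝ}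
    (hS : ∑ i, |d i| ≤ S)
    (h : ∑ k ∈ Finset.range N, (k + 2) / 2 ^ (k + 1) * |∑ i, d i * g i ^ (k + 1)|
      + 2 * S * (2 / 5) ^ N ≤ ∑ i, d i) :
    0 ≤ ∑ i, d i * (1 + g i * t) ^ (-e) := by
  set b : ℕ → ℝ := Ring.choose (-e)
  set m : ℕ → ℝ := fun k => ∑ i, d i * g i ^ k
  have hS0 : 0 ≤ S := (Finset.sum_nonneg fun i _ => abs_nonneg (d i)).trans hS
  have hgt : ∀ i, |g i * t| ≤ 3 / 10 := fun i => by
    rw [abs_mul]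
    calc |g i| * |t| ≤ 3 / 5 * (1 / 2) := by gcongr; exact hg i
      _ = 3 / 10 := by norm_num
  have hsum : HasSum (fun k => b k * m k * t ^ k) (∑ i, d i * (1 + g i * t) ^ (-e)) := by
    have := hasSum_sum (s := Finset.univ) fun i _ =>
      (hasSum_one_add_rpow (-e) (z := g i * t) ((hgt i).trans_lt (by norm_num))).mul_left (d i)
    refine this.congr_fun fun k => ?_
    simp only [m, Finset.mul_sum, Finset.sum_mul]
    exact Finset.sum_congr rfl fun i _ => by rw [mul_pow]; ring
  have hb : ∀ k, |b k| ≤ k + 1 := abs_choose_neg_le he he2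
  have htk : ∀ k, |t| ^ k ≤ 1 / 2 ^ k := fun k => by
    rw [← one_div_pow]
    exact pow_le_pow_left₀ (abs_nonneg t) ht k
  have hm : ∀ k, |m k| ≤ S * (3 / 5) ^ k := fun k => by
    refine (Finset.abs_sum_le_sum_abs _ _).trans ?_
    refine le_trans ?_ (mul_le_mul_of_nonneg_right hS (by positivity))
    rw [Finset.sum_mul]
    refine Finset.sum_le_sum fun i _ => ?_
    rw [abs_mul, abs_pow]
    have := hg i
    gcongr
  have hterm : ∀ k, ‖b k * m k * t ^ k‖ ≤ (k + 1) / 2 ^ k * |m k| := fun k => by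
    rw [Real.norm_eq_abs, abs_mul, abs_mul, abs_pow]
    calc |b k| * |m k| * |t| ^ k ≤ (k + 1) * |m k| * (1 / 2 ^ k) := by
          gcongr
          · exact hb k
          · exact htk k
      _ = _ := by ring
  have htail : ∀ k, ‖b (k + (N + 1)) * m (k + (N + 1)) * t ^ (k + (N + 1))‖
      ≤ 3 * S * (2 / 5) ^ (N + 1) * (2 / 5) ^ k := fun k => by
    set l := k + (N + 1) with hl
    calc ‖b l * m l * t ^ l‖ ≤ (l + 1) / 2 ^ l * |m l| := hterm l
      _ ≤ 3 * (4 / 3) ^ l / 2 ^ l * (S * (3 / 5) ^ l) := by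
          gcongr
          · exact natCast_add_one_le l
          · exact hm l
      _ = 3 * S * (4 / 3 / 2 * (3 / 5)) ^ l := by
          rw [mul_pow (4 / 3 / 2 : ℝ), div_pow (4 / 3 : ℝ) 2]
          ring
      _ = 3 * S * (2 / 5) ^ (N + 1) * (2 / 5) ^ k := by
          rw [hl, pow_add]
          norm_num
          ring
  have hgeo : HasSum (fun k : ℕ => 3 * S * (2 / 5) ^ (N + 1) * (2 / 5 : ℝ) ^ k)
      (2 * S * (2 / 5) ^ N) := by
    have := (hasSum_geometric_of_lt_one (r := (2 / 5 : ℝ)) (by norm_num) (by norm_num)).mul_left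
      (3 * S * (2 / 5) ^ (N + 1))
    convert! this using 1
    rw [pow_succ]
    norm_num
    ring
  have h1 := tsum_of_norm_bounded hgeo htail
  have h2 := hsum.summable.sum_add_tsum_nat_add (N + 1)
  rw [hsum.tsum_eq, Finset.sum_range_succ'] at h2
  have h3 : |∑ k ∈ Finset.range N, b (k + 1) * m (k + 1) * t ^ (k + 1)|
      ≤ ∑ k ∈ Finset.range N, (k + 2) / 2 ^ (k + 1) * |m (k + 1)| := by
    refine (Finset.abs_sum_le_sum_abs _ _).trans (Finset.sum_le_sum fun k _ => ?_)
    refine (hterm (k + 1)).trans_eq ?_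
    push_cast
    ring
  have h4 : b 0 * m 0 * t ^ 0 = ∑ i, d i := by simp [b, m]
  rw [Real.norm_eq_abs] at h1
  rw [h4] at h2
  linarith [neg_abs_le (∑ k ∈ Finset.range N, b (k + 1) * m (k + 1) * t ^ (k + 1)),
    neg_abs_le (∑' k, b (k + (N + 1)) * m (k + (N + 1)) * t ^ (k + (N + 1)))]

/-! ### Rational certificates for logarithms and powers -/

/-- The sum `∑ i < n, w ^ i / (2 * (i + k) + 1)`, by Horner's scheme. -/
def oddReciprocalSum (w : ℚ) : ℕ → ℕ → ℚ
  | 0, _ => 0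
  | n + 1, k => 1 / (2 * k + 1) + w * oddReciprocalSum w n (k + 1)

/-- A rational lower bound for `log u`. -/
def logLower (u : ℚ) (n : ℕ) : ℚ :=
  2 * ((u - 1) / (u + 1)) * oddReciprocalSum (((u - 1) / (u + 1)) ^ 2) n 0

/-- A rational upper bound for `log u`. -/
def logUpper (u : ℚ) (n : ℕ) : ℚ :=
  logLower u n + 2 * ((u - 1) / (u + 1)) ^ (2 * n + 1) / (1 - ((u - 1) / (u + 1)) ^ 2)

lemma oddReciprocalSum_eq (w : ℚ) (n k : ℕ) :
    oddReciprocalSum w n k = ∑ i ∈ Finset.range n, w ^ i / (2 * (i + k) + 1) := by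
  induction n generalizing k with
  | zero => rfl
  | succ n ih =>
    rw [oddReciprocalSum, ih, Finset.sum_range_succ', Finset.mul_sum, add_comm]
    congr 1
    · refine Finset.sum_congr rfl fun i _ => ?_
      push_cast
      rw [pow_succ', add_right_comm (i : ℚ) 1 k, add_assoc (i : ℚ) k 1, mul_div_assoc]
    · simp

lemma logLower_eq (u : ℚ) (n : ℕ) : ((logLower u n : ℚ) : ℝ) =
    2 * ∑ i ∈ Finset.range n, (((u : ℝ) - 1) / (u + 1)) ^ (2 * i + 1) / (2 * i + 1) := by
  rw [logLower, oddReciprocalSum_eq, Finset.mul_sum, Finset.mul_sum]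
  push_cast
  refine Finset.sum_congr rfl fun i _ => ?_
  rw [pow_succ _ (2 * i), pow_mul]
  simp only [add_zero]
  ring

/-- With `z = (u - 1) / (u + 1)`, `log u = log ((1 + z) / (1 - z))` has an odd power series in `z`
with nonnegative terms, so truncation bounds it from below. -/
lemma logLower_le {u : ℚ} (hu : 1 ≤ u) (n : ℕ) : (logLower u n : ℝ) ≤ Real.log u := by
  have hu' : (1 : ℝ) ≤ u := by exact_mod_cast hu
  have h := Real.sum_range_le_log_div (x := ((u : ℝ) - 1) / (u + 1))
    (div_nonneg (by linarith) (by linarith)) (by rw [div_lt_one (by linarith)]; linarith) n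
  have e : (1 + ((u : ℝ) - 1) / (u + 1)) / (1 - (u - 1) / (u + 1)) = u := by
    have : (u : ℝ) + 1 ≠ 0 := by linarith
    field_simp
    ring
  rw [e] at h
  rw [logLower_eq]
  linarith

lemma le_logUpper {u : ℚ} (hu : 1 ≤ u) (n : ℕ) : Real.log u ≤ (logUpper u n : ℝ) := by
  have hu' : (1 : ℝ) ≤ u := by exact_mod_cast hu
  have h := Real.log_div_le_sum_range_add (x := ((u : ℝ) - 1) / (u + 1))
    (div_nonneg (by linarith) (by linarith)) (by rw [div_lt_one (by linarith)]; linarith) n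
  have e : (1 + ((u : ℝ) - 1) / (u + 1)) / (1 - (u - 1) / (u + 1)) = u := by
    have : (u : ℝ) + 1 ≠ 0 := by linarith
    field_simp
    ring
  rw [e] at h
  rw [logUpper, Rat.cast_add, logLower_eq]
  push_cast
  rw [mul_div_assoc]
  linarith

/-- A rational certificate for `a ^ (-e) ≤ v`. -/
lemma rpow_neg_le_of_log {a v e : ℚ} (n : ℕ) (ha : 1 ≤ a) (hv : 0 < v) (hva : v * a ≤ 1)
    (he : 1 ≤ e) (h : logUpper (1 / (v * a)) n ≤ (e - 1) * logLower a n) :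
    (a : ℝ) ^ (-(e : ℝ)) ≤ v := by
  have ha0 : 0 < a := by linarith
  have haR : (0 : ℝ) < a := by exact_mod_cast ha0
  have hvR : (0 : ℝ) < v := by exact_mod_cast hv
  have heR : (1 : ℝ) ≤ e := by exact_mod_cast he
  -- One factor `a` is split off: `1 / (v * a)` is closer to 1 than `1 / v`, so its series converges
  -- faster.
  have h1 := le_logUpper (u := 1 / (v * a)) (by rw [le_div_iff₀ (by positivity)]; linarith) n
  have h2 := mul_le_mul_of_nonneg_left (logLower_le ha n) (sub_nonneg.2 heR)
  have h3 : ((logUpper (1 / (v * a)) n : ℚ) : ℝ) ≤ ((e : ℝ) - 1) * (logLower a n : ℝ) := by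
    exact_mod_cast h
  rw [Rat.cast_div, Rat.cast_one, Rat.cast_mul, one_div ((v : ℝ) * a), Real.log_inv, Real.log_mul hvR.ne' haR.ne'] at h1
  rw [← Real.log_le_log_iff (Real.rpow_pos_of_pos haR _) hvR, Real.log_rpow haR]
  linarith

/-- A rational certificate for `v ≤ a ^ (-e)`. -/
lemma le_rpow_neg_of_log {a v e : ℚ} (n : ℕ) (ha : 1 ≤ a) (hv : 0 < v) (hva : v * a ≤ 1)
    (he : 1 ≤ e) (h : (e - 1) * logUpper a n ≤ logLower (1 / (v * a)) n) :
    (v : ℝ) ≤ (a : ℝ) ^ (-(e : ℝ)) := by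
  have ha0 : 0 < a := by linarith
  have haR : (0 : ℝ) < a := by exact_mod_cast ha0
  have hvR : (0 : ℝ) < v := by exact_mod_cast hv
  have heR : (1 : ℝ) ≤ e := by exact_mod_cast he
  have h1 := logLower_le (u := 1 / (v * a)) (by rw [le_div_iff₀ (by positivity)]; linarith) n
  have h2 := mul_le_mul_of_nonneg_left (le_logUpper ha n) (sub_nonneg.2 heR)
  have h3 : ((e : ℝ) - 1) * (logUpper a n : ℝ) ≤ ((logLower (1 / (v * a)) n : ℚ) : ℝ) := by
    exact_mod_cast h
  rw [Rat.cast_div, Rat.cast_one, Rat.cast_mul, one_div ((v : ℝ) * a), Real.log_inv, Real.log_mul hvR.ne' haR.ne'] at h1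
  rw [← Real.log_le_log_iff hvR (Real.rpow_pos_of_pos haR _), Real.log_rpow haR]
  linarith

/-- Two affine functions that are ordered at `±1/2` are ordered in between. -/
lemma affine_le_of_le {a b c d t : ℝ} (ht : |t| ≤ 1 / 2) (h1 : a + b / 2 ≤ c + d / 2)
    (h2 : a - b / 2 ≤ c - d / 2) : a + b * t ≤ c + d * t := by
  obtain ⟨h3, h4⟩ := abs_le.1 ht
  nlinarith

lemma one_add_mul_pos {g t : ℝ} (hg : |g| ≤ 3 / 5) (ht : |t| ≤ 1 / 2) : 0 < 1 + g * t := by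
  have h : |g * t| ≤ 3 / 5 * (1 / 2) := by
    rw [abs_mul]
    exact mul_le_mul hg ht (abs_nonneg _) (by norm_num)
  linarith [neg_abs_le (g * t)]

/-! ### Approximate eigenfunctions as sums of powers of affine functions -/

/-- Numerical data for an approximate eigenfunction `x ↦ ∑ j, c_j (1 + β_j (x - 1/2)) ^ (-e)` of the
transfer operator with digits `1, 2, 3, 5`. -/
structure TransferData where
  /-- The exponent `e`. -/
  exponent : ℚ
  /-- The relative perturbation of the shifts that absorbs rounding errors. -/
  tilt : ℚ
  /-- The slopes `β_j`. -/
  node : Fin 8 → ℚ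
  /-- The coefficients `c_j`. -/
  coeff : Fin 8 → ℚ
  /-- Bounds for the powers of the perturbed shifts. -/
  power : Fin 8 → Fin 4 → ℚ

namespace TransferData

variable (D : TransferData)

/-- The digits of the iterated function scheme. -/
def digit : Fin 4 → ℕ := ![1, 2, 3, 5]

/-- The slope of `(x + n) * (1 + β_j (1 / (x + n) - 1 / 2))`. -/
def slope (j : Fin 8) : ℚ := 1 - D.node j / 2

/-- The value of `(x + n) * (1 + β_j (1 / (x + n) - 1 / 2))` at `x = 1 / 2`. -/
def shift (j : Fin 8) (n : Fin 4) : ℚ := D.slope j * (digit n + 1 / 2) + D.node j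

/-- The perturbed shift. -/
def tilted (j : Fin 8) (n : Fin 4) : ℚ := D.shift j n * (1 + D.tilt)

/-- The ratio of slope and shift, rounded to 16 decimals. -/
def ratio (j : Fin 8) (n : Fin 4) : ℚ := ⌊D.slope j / D.shift j n * 10 ^ 16⌋ / 10 ^ 16

/-- The moments of the residual. -/
def moment (k : ℕ) : ℚ := ∑ j, D.coeff j * D.node j ^ k -
  ∑ j, ∑ n, D.coeff j * D.power j n * D.ratio j n ^ k

/-- The conditions common to the upper and the lower bound. -/
def Admissible : Prop :=
  1 ≤ D.exponent ∧ D.exponent ≤ 2 ∧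
  (∀ j, 0 < D.coeff j ∧ 0 ≤ D.node j ∧ D.node j ≤ 3 / 5) ∧
  (∀ j n, 0 ≤ D.ratio j n ∧ D.ratio j n ≤ 3 / 5 ∧ 1 ≤ D.tilted j n ∧ 0 < D.power j n ∧
    D.power j n * D.tilted j n ≤ 1) ∧
  ∑ j, D.coeff j + ∑ j, ∑ n, D.coeff j * D.power j n ≤ 3

/-- The power bounds are upper bounds. -/
def PowerUpper : Prop := ∀ j n,
  D.tilted j n * (1 + D.ratio j n / 2) ≤ D.shift j n + D.slope j / 2 ∧
  D.tilted j n * (1 - D.ratio j n / 2) ≤ D.shift j n - D.slope j / 2 ∧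
  logUpper (1 / (D.power j n * D.tilted j n)) 60 ≤ (D.exponent - 1) * logLower (D.tilted j n) 60

/-- The power bounds are lower bounds. -/
def PowerLower : Prop := ∀ j n,
  D.shift j n + D.slope j / 2 ≤ D.tilted j n * (1 + D.ratio j n / 2) ∧
  D.shift j n - D.slope j / 2 ≤ D.tilted j n * (1 - D.ratio j n / 2) ∧
  (D.exponent - 1) * logUpper (D.tilted j n) 60 ≤ logLower (1 / (D.power j n * D.tilted j n)) 60

/-- The zeroth moment of the residual, multiplied by `sign`, dominates the others. -/
def MomentBound (sign : ℚ) : Prop :=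
  ∑ k ∈ Finset.range 40, ((k : ℚ) + 2) / 2 ^ (k + 1) * |D.moment (k + 1)|
    + 2 * 3 * (2 / 5) ^ 40 ≤ sign * D.moment 0

instance : Decidable D.Admissible := by unfold Admissible; infer_instance
instance : Decidable D.PowerUpper := by unfold PowerUpper; infer_instance
instance : Decidable D.PowerLower := by unfold PowerLower; infer_instance
instance (sign : ℚ) : Decidable (D.MomentBound sign) := by unfold MomentBound; infer_instance

/-- The function given by the data. -/
noncomputable def eigenfun (x : ℝ) : ℝ :=
  ∑ j, (D.coeff j : ℝ) * (1 + D.node j * (x - 1 / 2)) ^ (-(D.exponent : ℝ))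

variable {D}

lemma Admissible.abs_node_le (h : D.Admissible) (j : Fin 8) : |(D.node j : ℝ)| ≤ 3 / 5 := by
  obtain ⟨-, -, h, -⟩ := h
  obtain ⟨-, h1, h2⟩ := h j
  have h1' : (0 : ℝ) ≤ D.node j := by exact_mod_cast h1
  rw [abs_of_nonneg h1']
  exact ((Rat.cast_le (K := ℝ)).2 h2).trans_eq (by norm_num)

lemma Admissible.abs_ratio_le (h : D.Admissible) (j : Fin 8) (n : Fin 4) :
    |(D.ratio j n : ℝ)| ≤ 3 / 5 := by
  obtain ⟨-, -, -, h, -⟩ := h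
  obtain ⟨h1, h2, -⟩ := h j n
  have h1' : (0 : ℝ) ≤ D.ratio j n := by exact_mod_cast h1
  rw [abs_of_nonneg h1']
  exact ((Rat.cast_le (K := ℝ)).2 h2).trans_eq (by norm_num)

lemma abs_sub_half_le {x : ℝ} (hx : x ∈ Set.Icc (0 : ℝ) 1) : |x - 1 / 2| ≤ 1 / 2 :=
  abs_le.2 ⟨by linarith [hx.1], by linarith [hx.2]⟩

lemma Admissible.coeff_pos (h : D.Admissible) (j : Fin 8) : (0 : ℝ) < D.coeff j := by
  exact_mod_cast (h.2.2.1 j).1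

lemma Admissible.eigenfun_pos (h : D.Admissible) {x : ℝ} (hx : x ∈ Set.Icc (0 : ℝ) 1) :
    0 < D.eigenfun x :=
  Finset.sum_pos (fun j _ => mul_pos (h.coeff_pos j)
    (Real.rpow_pos_of_pos (one_add_mul_pos (h.abs_node_le j) (abs_sub_half_le hx)) _))
    Finset.univ_nonempty

lemma Admissible.continuousOn_eigenfun (h : D.Admissible) :
    ContinuousOn D.eigenfun (Set.Icc 0 1) := by
  unfold eigenfun
  refine continuousOn_finsetSum _ fun j _ => continuousOn_const.mul ?_
  refine ContinuousOn.rpow_const (by fun_prop) fun x hx => Or.inl ?_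
  exact (one_add_mul_pos (h.abs_node_le j) (abs_sub_half_le hx)).ne'

lemma one_le_digit (n : Fin 4) : (1 : ℝ) ≤ digit n := by
  fin_cases n <;> norm_num [digit]

lemma cast_shift (j : Fin 8) (n : Fin 4) :
    (D.shift j n : ℝ) = D.slope j * (digit n + 1 / 2) + D.node j := by
  simp [shift]

lemma cast_slope (j : Fin 8) : (D.slope j : ℝ) = 1 - D.node j / 2 := by
  simp [slope]

/-- The image of a power under a branch of the transfer operator. -/
lemma Admissible.branch_eq (h : D.Admissible) {x : ℝ} (hx : x ∈ Set.Icc (0 : ℝ) 1) (n : Fin 4) :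
    (x + digit n) ^ (-(D.exponent : ℝ)) * D.eigenfun (1 / (x + digit n)) =
      ∑ j, (D.coeff j : ℝ) *
        (D.shift j n + D.slope j * (x - 1 / 2)) ^ (-(D.exponent : ℝ)) := by
  have hn := one_le_digit n
  have hp : 0 < x + digit n := by linarith [hx.1]
  have hy : 1 / (x + digit n) ∈ Set.Icc (0 : ℝ) 1 :=
    ⟨by positivity, by rw [div_le_one hp]; linarith [hx.1]⟩
  rw [eigenfun, Finset.mul_sum]
  refine Finset.sum_congr rfl fun j _ => ?_
  have h1 := one_add_mul_pos (h.abs_node_le j) (abs_sub_half_le hy)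
  rw [mul_left_comm, ← Real.mul_rpow hp.le h1.le, cast_shift, cast_slope]
  congr 2
  field_simp
  ring

lemma sum_digits (F : ℕ → ℝ) : ∑ a ∈ ({1, 2, 3, 5} : Finset ℕ), F a = ∑ n, F (digit n) := by
  simp [digit, Fin.sum_univ_four]
  ring

/-- The residual after replacing the powers of the shifts by their rational bounds. -/
lemma Admissible.residual_nonneg (h : D.Admissible) {sign : ℚ} (hsign : |sign| = 1)
    (hM : D.MomentBound sign) {t : ℝ} (ht : |t| ≤ 1 / 2) :
    0 ≤ (sign : ℝ) * (∑ j, (D.coeff j : ℝ) * (1 + D.node j * t) ^ (-(D.exponent : ℝ)) -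
      ∑ j, ∑ n, (D.coeff j : ℝ) * D.power j n * (1 + D.ratio j n * t) ^ (-(D.exponent : ℝ))) := by
  obtain ⟨he1, he2, -, hpow, hS⟩ := id h
  have he1' : (1 : ℝ) ≤ D.exponent := by exact_mod_cast he1
  have he2' : (D.exponent : ℝ) ≤ 2 := by exact_mod_cast he2
  have hsR : |(sign : ℝ)| = 1 := by exact_mod_cast hsign
  have hp : ∀ j n, (0 : ℝ) < D.power j n := fun j n => by exact_mod_cast (hpow j n).2.2.2.1
  let d : Fin 8 ⊕ Fin 8 × Fin 4 → ℝ := Sum.elim (fun j => (sign : ℝ) * D.coeff j)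
    fun p => -((sign : ℝ) * (D.coeff p.1 * D.power p.1 p.2))
  let g : Fin 8 ⊕ Fin 8 × Fin 4 → ℝ := Sum.elim (fun j => (D.node j : ℝ))
    fun p => (D.ratio p.1 p.2 : ℝ)
  have hm : ∀ k, ∑ i, d i * g i ^ k = (sign : ℝ) * (D.moment k : ℝ) := fun k => by
    simp only [d, g, Fintype.sum_sum_type, Sum.elim_inl, Sum.elim_inr, Fintype.sum_prod_type,
      moment, neg_mul, Finset.sum_neg_distrib]
    push_cast
    simp only [mul_sub, Finset.mul_sum, mul_assoc]
    rw [sub_eq_add_neg]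
  have hm0 : ∑ i, d i = (sign : ℝ) * (D.moment 0 : ℝ) := by simpa using hm 0
  have key := sum_rpow_nonneg_of_moments (by linarith) he2' d g
    -- The combination has 8 terms from `f` and 32 from its image. With 40 moments and `S = 3` the
    -- neglected tail is at most `6 * (2/5) ^ 40 < 10 ^ (-15)`.
    (by
      rintro (j | p)
      exacts [h.abs_node_le j, h.abs_ratio_le p.1 p.2]) ht 40 (S := 3)
    (by
      simp only [d, Fintype.sum_sum_type, Sum.elim_inl, Sum.elim_inr, Fintype.sum_prod_type,
        abs_neg, abs_mul, hsR, one_mul, abs_of_pos (h.coeff_pos _), abs_of_pos (hp _ _)]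
      exact_mod_cast hS)
    (by
      simp only [hm, hm0, abs_mul, hsR, one_mul]
      have : ((∑ k ∈ Finset.range 40, ((k : ℚ) + 2) / 2 ^ (k + 1) * |D.moment (k + 1)|
        + 2 * 3 * (2 / 5) ^ 40 : ℚ) : ℝ) ≤ ((sign * D.moment 0 : ℚ) : ℝ) :=
        Rat.cast_le.2 hM
      push_cast at this
      exact this)
  refine key.trans_eq ?_
  simp only [d, g, Fintype.sum_sum_type, Sum.elim_inl, Sum.elim_inr, Fintype.sum_prod_type,
    neg_mul, Finset.sum_neg_distrib, mul_sub, Finset.mul_sum, mul_assoc]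
  rw [sub_eq_add_neg]

/-- The tilt pushes the affine function with rounded ratio below the exact one at both endpoints,
hence in between; the negative exponent reverses the inequality. -/
lemma Admissible.term_le (h : D.Admissible) (hP : D.PowerUpper) {t : ℝ} (ht : |t| ≤ 1 / 2)
    (j : Fin 8) (n : Fin 4) : ((D.shift j n : ℝ) + D.slope j * t) ^ (-(D.exponent : ℝ)) ≤
      D.power j n * (1 + D.ratio j n * t) ^ (-(D.exponent : ℝ)) := by
  obtain ⟨he1, -, -, hpow, -⟩ := id h
  obtain ⟨-, -, ha, hv, hva⟩ := hpow j n
  obtain ⟨h1, h2, h3⟩ := hP j n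
  have hle := rpow_neg_le_of_log 60 ha hv hva he1 h3
  have hr := one_add_mul_pos (h.abs_ratio_le j n) ht
  have haR : (0 : ℝ) < D.tilted j n := by
    have : (1 : ℝ) ≤ D.tilted j n := by exact_mod_cast ha
    linarith
  have he : -(D.exponent : ℝ) ≤ 0 := by
    have : (1 : ℝ) ≤ D.exponent := by exact_mod_cast he1
    linarith
  have haff : (D.tilted j n : ℝ) * (1 + D.ratio j n * t) ≤ D.shift j n + D.slope j * t := by
    rw [mul_one_add, ← mul_assoc]
    have h1' : (D.tilted j n : ℝ) * (1 + D.ratio j n / 2) ≤ D.shift j n + D.slope j / 2 := by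
      exact_mod_cast h1
    have h2' : (D.tilted j n : ℝ) * (1 - D.ratio j n / 2) ≤ D.shift j n - D.slope j / 2 := by
      exact_mod_cast h2
    exact affine_le_of_le ht (by linarith) (by linarith)
  refine (Real.rpow_le_rpow_of_nonpos (mul_pos haR hr) haff he).trans ?_
  rw [Real.mul_rpow haR.le hr.le]
  exact mul_le_mul_of_nonneg_right hle (Real.rpow_nonneg hr.le _)

lemma Admissible.le_term (h : D.Admissible) (hP : D.PowerLower) {t : ℝ} (ht : |t| ≤ 1 / 2)
    (j : Fin 8) (n : Fin 4) : D.power j n * (1 + D.ratio j n * t) ^ (-(D.exponent : ℝ)) ≤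
      ((D.shift j n : ℝ) + D.slope j * t) ^ (-(D.exponent : ℝ)) := by
  obtain ⟨he1, -, hnode, hpow, -⟩ := id h
  obtain ⟨-, -, ha, hv, hva⟩ := hpow j n
  obtain ⟨h1, h2, h3⟩ := hP j n
  have hle := le_rpow_neg_of_log 60 ha hv hva he1 h3
  have hr := one_add_mul_pos (h.abs_ratio_le j n) ht
  have haR : (0 : ℝ) < D.tilted j n := by
    have : (1 : ℝ) ≤ D.tilted j n := by exact_mod_cast ha
    linarith
  have he : -(D.exponent : ℝ) ≤ 0 := by
    have : (1 : ℝ) ≤ D.exponent := by exact_mod_cast he1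
    linarith
  have haff : (D.shift j n : ℝ) + D.slope j * t ≤ D.tilted j n * (1 + D.ratio j n * t) := by
    rw [mul_one_add, ← mul_assoc]
    have h1' : (D.shift j n : ℝ) + D.slope j / 2 ≤ D.tilted j n * (1 + D.ratio j n / 2) := by
      exact_mod_cast h1
    have h2' : (D.shift j n : ℝ) - D.slope j / 2 ≤ D.tilted j n * (1 - D.ratio j n / 2) := by
      exact_mod_cast h2
    exact affine_le_of_le ht (by linarith) (by linarith)
  have hpos : 0 < (D.shift j n : ℝ) + D.slope j * t := by
    have hn : (0 : ℝ) ≤ D.node j := by exact_mod_cast (hnode j).2.1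
    have hn' : (D.node j : ℝ) ≤ 3 / 5 :=
      ((Rat.cast_le (K := ℝ)).2 (hnode j).2.2).trans_eq (by norm_num)
    have hd := one_le_digit n
    rw [cast_shift, cast_slope]
    obtain ⟨t1, t2⟩ := abs_le.1 ht
    have : 0 < (1 - (D.node j : ℝ) / 2) * (digit n + 1 / 2 + t) :=
      mul_pos (by linarith) (by linarith)
    linarith
  refine le_trans ?_ (Real.rpow_le_rpow_of_nonpos hpos haff he)
  rw [Real.mul_rpow haR.le hr.le]
  exact mul_le_mul_of_nonneg_right hle (Real.rpow_nonneg hr.le _)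

lemma Admissible.transfer_eq (h : D.Admissible) {x : ℝ} (hx : x ∈ Set.Icc (0 : ℝ) 1) :
    ∑ a ∈ ({1, 2, 3, 5} : Finset ℕ),
        (x + a) ^ (-(D.exponent : ℝ)) * D.eigenfun (1 / (x + a)) =
      ∑ j, ∑ n, (D.coeff j : ℝ) *
        (D.shift j n + D.slope j * (x - 1 / 2)) ^ (-(D.exponent : ℝ)) := by
  rw [sum_digits fun a => (x + a) ^ (-(D.exponent : ℝ)) * D.eigenfun (1 / (x + a)),
    Finset.sum_comm]
  exact Finset.sum_congr rfl fun n _ => h.branch_eq hx n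

theorem Admissible.transfer_le (h : D.Admissible) (hP : D.PowerUpper) (hM : D.MomentBound 1)
    {x : ℝ} (hx : x ∈ Set.Icc (0 : ℝ) 1) :
    ∑ a ∈ ({1, 2, 3, 5} : Finset ℕ),
      (x + a) ^ (-(D.exponent : ℝ)) * D.eigenfun (1 / (x + a)) ≤ D.eigenfun x := by
  have ht := abs_sub_half_le hx
  have hr := h.residual_nonneg (by simp) hM ht
  rw [Rat.cast_one, one_mul, sub_nonneg] at hr
  rw [h.transfer_eq hx]
  refine le_trans (Finset.sum_le_sum fun j _ => Finset.sum_le_sum fun n _ => ?_) hr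
  rw [mul_assoc]
  exact mul_le_mul_of_nonneg_left (h.term_le hP ht j n) (h.coeff_pos j).le

theorem Admissible.le_transfer (h : D.Admissible) (hP : D.PowerLower) (hM : D.MomentBound (-1))
    {x : ℝ} (hx : x ∈ Set.Icc (0 : ℝ) 1) :
    D.eigenfun x ≤ ∑ a ∈ ({1, 2, 3, 5} : Finset ℕ),
      (x + a) ^ (-(D.exponent : ℝ)) * D.eigenfun (1 / (x + a)) := by
  have ht := abs_sub_half_le hx
  have hr := h.residual_nonneg (by simp) hM ht
  rw [Rat.cast_neg, Rat.cast_one, neg_one_mul, neg_sub, sub_nonneg] at hr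
  rw [h.transfer_eq hx]
  refine le_trans hr (Finset.sum_le_sum fun j _ => Finset.sum_le_sum fun n _ => ?_)
  rw [mul_assoc]
  exact mul_le_mul_of_nonneg_left (h.le_term hP ht j n) (h.coeff_pos j).le

end TransferData

/-! ### Explicit certificates and the conclusion -/

/-- Data for a subsolution of the transfer operator. -/
def upperData : TransferData where
  exponent := 2 * 0.770914939939
  tilt := -1 / 10 ^ 15
  node j := ![1646078872496718, 2326721125462284, 2857766384262313, 3512296171008527,
    4543302950655620, 5162952037199905, 5584254485648581, 5950709044873750] j / 10 ^ 16
  coeff j := ![831671572023584, 994457753337054, 1547623841728534, 1817543163411078,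
    1903158056301173, 1421611251602348, 1030815037589843, 453119324006385] j / 10 ^ 16
  power j n := ![![5133035257131117, 2497803151178191, 1531741311397319, 784349056155242],
    ![5046863213963118, 2524691000332043, 1568144866000816, 812811852460754],
    ![4981273740194652, 2546002318926149, 1597549317703950, 836222358838238],
    ![4902345516120057, 2572680073505320, 1635061482968118, 866643137268287],
    ![4782129435998725, 2615647981261843, 1697172504775822, 918414164583530],
    ![4712196631659362, 2642044754789479, 1736398176828164, 952033585688307],
    ![4665606166339684, 2660243880273340, 1763929485384853, 976067620871777],
    ![4625695370703833, 2676242423520476, 1788466931590429, 997797575626737]] j n / 10 ^ 16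

/-- Data for a supersolution of the transfer operator. -/
def lowerData : TransferData where
  exponent := 2 * 0.770914939936
  tilt := 1 / 10 ^ 15
  node j := ![1646078872496764, 2326721125461429, 2857766384260754, 3512296171008230,
    4543302950655142, 5162952037199874, 5584254485648612, 5950709044873728] j / 10 ^ 16
  coeff j := ![831671572027196, 994457753335506, 1547623841731153, 1817543163414882,
    1903158056294229, 1421611251600211, 1030815037589405, 453119324007419] j / 10 ^ 16
  power j n := ![![5133035257144415, 2497803151191668, 1531741311408499, 784349056163010],
    ![5046863213976639, 2524691000345524, 1568144866012069, 812811852468652],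
    ![4981273740208335, 2546002318939631, 1597549317715258, 836222358846239],
    ![4902345516133676, 2572680073518891, 1635061482979617, 866643137276518],
    ![4782129436012492, 2615647981275464, 1697172504787500, 918414164592035],
    ![4712196631673147, 2642044754803154, 1736398176839986, 952033585697014],
    ![4665606166353506, 2660243880287040, 1763929485396759, 976067620880612],
    ![4625695370717698, 2676242423534194, 1788466931602400, 997797575635680]] j n / 10 ^ 16

/-- These conditions are finitely many inequalities between explicit rationals, so evaluation
decides them; how the data were found plays no role. -/
lemma upperData_admissible : upperData.Admissible := by decide +kernel

lemma upperData_powerUpper : upperData.PowerUpper := by decide +kernel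

lemma upperData_momentBound : upperData.MomentBound 1 := by decide +kernel

lemma lowerData_admissible : lowerData.Admissible := by decide +kernel

lemma lowerData_powerLower : lowerData.PowerLower := by decide +kernel

lemma lowerData_momentBound : lowerData.MomentBound (-1) := by decide +kernel

lemma dimH_gaussLimitSet_1235_le :
    dimH (gaussLimitSet {1, 2, 3, 5}) ≤ ENNReal.ofReal 0.770914939939 := by
  have he : ((upperData.exponent : ℚ) : ℝ) = 2 * 0.770914939939 := by
    simp only [upperData]
    push_cast
    norm_num
  refine dimH_gaussLimitSet_le (f := upperData.eigenfun) (by simp) (by norm_num)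
    upperData_admissible.continuousOn_eigenfun
    (fun x hx => upperData_admissible.eigenfun_pos hx) fun x hx => ?_
  rw [← he]
  exact upperData_admissible.transfer_le upperData_powerUpper upperData_momentBound hx

lemma le_dimH_gaussLimitSet_1235 :
    ENNReal.ofReal 0.770914939936 ≤ dimH (gaussLimitSet {1, 2, 3, 5}) := by
  have he : ((lowerData.exponent : ℚ) : ℝ) = 2 * 0.770914939936 := by
    simp only [lowerData]
    push_cast
    norm_num
  refine le_dimH_gaussLimitSet (f := lowerData.eigenfun) (by simp) (by simp) (by norm_num)
    lowerData_admissible.continuousOn_eigenfun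
    (fun x hx => lowerData_admissible.eigenfun_pos hx) fun x hx => ?_
  rw [← he]
  exact lowerData_admissible.le_transfer lowerData_powerLower lowerData_momentBound hx

theorem mainTheorem8 :
    |(dimH (gaussLimitSet {1, 2, 3, 5})).toReal - 0.7709149399375| ≤ 1.5 * (10 : ℝ) ^ (-12 : ℤ) ∧
      3 - Real.sqrt 5 < (dimH (gaussLimitSet {1, 2, 3, 5})).toReal := by
  have hup := dimH_gaussLimitSet_1235_le
  have hlo := le_dimH_gaussLimitSet_1235
  have hfin : dimH (gaussLimitSet {1, 2, 3, 5}) ≠ ⊤ := ne_top_of_le_ne_top ENNReal.ofReal_ne_top hup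
  have h1 : (dimH (gaussLimitSet {1, 2, 3, 5})).toReal ≤ 0.770914939939 :=
    ENNReal.toReal_le_of_le_ofReal (by norm_num) hup
  have h2 : 0.770914939936 ≤ (dimH (gaussLimitSet {1, 2, 3, 5})).toReal :=
    (ENNReal.ofReal_le_iff_le_toReal hfin).1 hlo
  -- This gives `3 - √5 < 0.77`, already below the lower bound for the dimension.
  have h3 : (2.23 : ℝ) < Real.sqrt 5 := Real.lt_sqrt_of_sq_lt (by norm_num)
  refine ⟨?_, by linarith⟩
  rw [show (10 : ℝ) ^ (-12 : ℤ) = 1 / 10 ^ 12 by norm_num, abs_le]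
  constructor <;> linarith
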